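/- Let $p_1<p_2$ be finite real numbers, $\mu\in(0,1)$, and let $U:(p_1,p_2)\to\mathbb C$ be of the form $U(p)=(p-p_1)^{\mu-1}\,\tilde u(p)$ with $\tilde u\in\mathcal C^1([p_1,p_2],\mathbb C)$, $\tilde u(p_1)\neq 0$, and $U(p_2)=0$ (that is, $U(p)\to0$ as $p\to p_2^-$). Let $\varepsilon\in(0,\tfrac12)$, and fix $\delta\in(\tfrac12,1)$ with $\delta>\tfrac12+\varepsilon$ and $\delta>\mu$; put $\gamma:=2\delta-1\in(0,1)$. Write $S:=\|\tilde u\|_{L^\infty(p_1,p_2)}$, $W:=\max\big(\|\tilde u\|_{L^\infty(p_1,p_2)},\|\tilde u'\|_{L^\infty(p_1,p_2)}\big)$, and $L_\gamma:=\frac{\sqrt\pi}{2}K^\gamma$, where $K$ is the unique positive solution of $\frac{\sqrt\pi}{2}K^2-\frac12K-\frac{\sqrt\pi}{4}=0$. Define, for $k=1,\dots,8$, $$\begin{array}{c|ccc} k & R_k & \alpha_k & \beta_k\\ \hline 1 & \frac{2^{2-\mu}}{\mu}(2-\mu)W & 2-\mu & 1\\ 2 & \frac{2^{1-\mu}}{\mu}W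 & 1-\mu & 1\\ 3 & (1-\mu)\frac{2^{3-\mu}}{3}S & 4-\mu & 2\\ 4 & \frac{L_\gamma}{1-\gamma}2^{2-\mu}(1-\mu)W & 1+\gamma-\mu & \delta\\ 5 & \frac{L_\gamma}{1-\gamma}2^{1-\mu}W & \gamma-\mu & \delta\\ 6 & \frac{\sqrt\pi}{2^{\mu-2}}S & 3-\mu & \frac32\\ 7 & \frac{L_\gamma}{1-\gamma}(1-\mu)(p_2-p_1)^{1-\gamma}W & 2-\mu & \delta\\ 8 & \frac{L_\gamma}{1-\gamma}(p_2-p_1)^{1-\gamma}W & 1-\mu & \delta \end{array}$$ and let $(\tilde R^{(2)}_k,\tilde\alpha^{(2)}_k,\tilde\beta^{(2)}_k):=(R_k,\alpha_k,\beta_k)$ for $1\le k\le 8$; for $j\in\{1,3\}$ let $(\tilde R^{(j)}_{k+1},\tilde\alpha^{(j)}_{k+1},\tilde\beta^{(j)}_{k+1}):=(R_k,\alpha_k,\beta_k)$ for $1\le k\le8$, with first entries $$(\tilde R^{(1)}_1,\tilde\alpha^{(1)}_1,\tilde\beta^{(1)}_1):=\Big(\tfrac{\Gamma(\mu)}{2^\mu}S,\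 \mu,\ \mu\Big),\qquad (\tilde R^{(3)}_1,\tilde\alpha^{(3)}_1,\tilde\beta^{(3)}_1):=\big(\sqrt\pi\,S,\ 1-\mu,\ \tfrac12\big).$$ All these constants are non-negative, and none of them depends on $\omega$, $p_0$ or $c$ below. Let $c\in\mathbb R$ and $\omega>(p_2-p_1)^{-1/\varepsilon}$ be arbitrary, and set $p_0:=p_1+\omega^{-\varepsilon}$ (so $p_0\in(p_1,p_2)$), $\psi(p):=-(p-p_0)^2+c$, and $$\tilde H:=\sqrt\pi\,e^{-i\pi/4}e^{i\omega c}\,\tilde u(p_0),\qquad \tilde K_\mu:=\frac{\Gamma(\mu)}{2^\mu}e^{i\pi\mu/2}e^{i\omega\psi(p_1)}\,\tilde u(p_1).$$ Then $U e^{i\omega\psi}$ is integrable on $(p_1,p_2)$, and: * if $\mu>\frac12$: $$\Big|\int_{p_1}^{p_2}U(p)e^{i\omega\psi(p)}\,dp-\tilde H\,\omega^{-\frac12+\varepsilon(1-\mu)}\Big|\le\sum_{k=1}^9\tilde R^{(1)}_k\,\omega^{-\tilde\beta^{(1)}_k+\varepsilon\tilde\alpha^{(1)}_k},\qquad \max_{1\le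 k\le9}\big\{-\tilde\beta^{(1)}_k+\varepsilon\tilde\alpha^{(1)}_k\big\}<-\tfrac12+\varepsilon(1-\mu);$$ * if $\mu=\frac12$: $$\Big|\int_{p_1}^{p_2}U(p)e^{i\omega\psi(p)}\,dp-(\tilde H+\tilde K_\mu)\,\omega^{-\frac12+\frac12\varepsilon}\Big|\le\sum_{k=1}^8\tilde R^{(2)}_k\,\omega^{-\tilde\beta^{(2)}_k+\varepsilon\tilde\alpha^{(2)}_k},\qquad \max_{1\le k\le8}\big\{-\tilde\beta^{(2)}_k+\varepsilon\tilde\alpha^{(2)}_k\big\}<-\tfrac12+\tfrac12\varepsilon;$$ * if $\mu<\frac12$: $$\Big|\int_{p_1}^{p_2}U(p)e^{i\omega\psi(p)}\,dp-\tilde K_\mu\,\omega^{-\mu+\varepsilon\mu}\Big|\le\sum_{k=1}^9\tilde R^{(3)}_k\,\omega^{-\tilde\beta^{(3)}_k+\varepsilon\tilde\alpha^{(3)}_k},\qquad \max_{1\le k\le9}\big\{-\tilde\beta^{(3)}_k+\varepsilon\tilde\alpha^{(3)}_k\big\}<-\mu+\varepsilon\mu.$$ -/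

import Mathlib

namespace OscInt

open MeasureTheory Set

/-- `u` is the regular part of an amplitude `U` on `(p₁, p₂)` with singularities of orders
`μ₁ - 1` at `p₁` and `μ₂ - 1` at `p₂`: the amplitude condition (A) with parameters `μ₁, μ₂, N`,
the regular part being displayed. Only the values of `U` on the open interval `(p₁, p₂)` and
those of `u` on `[p₁, p₂]` matter; `u` is determined on `[p₁, p₂]` by `U`. -/
structure IsRegularPart (p₁ p₂ μ₁ μ₂ : ℝ) (N : ℕ) (U u : ℝ → ℂ) : Prop where
  contDiffOn : ContDiffOn ℝ N u (Icc p₁ p₂)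
  eq_mul : ∀ p ∈ Ioo p₁ p₂,
    U p = (((p - p₁) ^ (μ₁ - 1) * (p₂ - p) ^ (μ₂ - 1) : ℝ) : ℂ) * u p
  ne_zero_left : μ₁ ≠ 1 → u p₁ ≠ 0
  ne_zero_right : μ₂ ≠ 1 → u p₂ ≠ 0

/-- The quadratic phase `ψ(p) = -(p - p₀)² + c`. -/
noncomputable def phase (p₀ c p : ℝ) : ℝ := -(p - p₀) ^ 2 + c

/-- The integrand `U(p) exp(i ω ψ(p))`. -/
noncomputable def integrand (U : ℝ → ℂ) (ψ : ℝ → ℝ) (ω p : ℝ) : ℂ :=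
  U p * Complex.exp (Complex.I * ω * ψ p)

/-- The norm of `L^∞(p₁, p₂)`. -/
noncomputable def linftyNorm (p₁ p₂ : ℝ) (f : ℝ → ℂ) : ℝ :=
  (eLpNorm f ⊤ (volume.restrict (Ioo p₁ p₂))).toReal

/-- The norm of `W^{1,∞}(p₁, p₂)`, in the normalization `max (‖f‖_∞, ‖f'‖_∞)`
(the smallest of the usual equivalent ones). -/
noncomputable def w1inftyNorm (p₁ p₂ : ℝ) (f : ℝ → ℂ) : ℝ :=
  max (linftyNorm p₁ p₂ f) (linftyNorm p₁ p₂ (deriv f))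

/-- `H̃ = √π e^{-iπ/4} e^{iωc} u(p₀)`. -/
noncomputable def coeffH (u : ℝ → ℂ) (p₀ c ω : ℝ) : ℂ :=
  (Real.sqrt Real.pi : ℂ) * Complex.exp (-(Complex.I * (Real.pi / 4)))
    * Complex.exp (Complex.I * ω * c) * u p₀

/-- `K̃_μ = Γ(μ) 2^{-μ} e^{iπμ/2} e^{iωψ(p₁)} u(p₁)`. -/
noncomputable def coeffK (μ : ℝ) (ψ : ℝ → ℝ) (u : ℝ → ℂ) (p₁ ω : ℝ) : ℂ :=
  ((Real.Gamma μ / 2 ^ μ : ℝ) : ℂ) * Complex.exp (Complex.I * (Real.pi * μ / 2))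
    * Complex.exp (Complex.I * ω * ψ p₁) * u p₁

/-- The positive solution of `a K² - b K - c = 0` with `a = √π / 2`, `b = 1 / 2`, `c = √π / 4`. -/
noncomputable def rootK : ℝ :=
  (1 / 2 + Real.sqrt (1 / 4 + Real.pi / 2)) / Real.sqrt Real.pi

theorem rootK_unique (K : ℝ) :
    (0 < K ∧ Real.sqrt Real.pi / 2 * K ^ 2 - 1 / 2 * K - Real.sqrt Real.pi / 4 = 0) ↔
      K = rootK := by
  have hs : 0 < Real.sqrt Real.pi := Real.sqrt_pos.2 Real.pi_pos
  have hs2 : Real.sqrt Real.pi ^ 2 = Real.pi := Real.sq_sqrt Real.pi_pos.le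
  have hr0 : 0 < Real.sqrt (1 / 4 + Real.pi / 2) := Real.sqrt_pos.2 (by positivity)
  have hr2 : Real.sqrt (1 / 4 + Real.pi / 2) ^ 2 = 1 / 4 + Real.pi / 2 :=
    Real.sq_sqrt (by positivity)
  unfold rootK
  generalize Real.sqrt (1 / 4 + Real.pi / 2) = r at *
  generalize Real.sqrt Real.pi = s at *
  have hrs : r ^ 2 = 1 / 4 + s ^ 2 / 2 := by rw [hr2, hs2]
  have hr : 1 / 2 < r := by nlinarith
  rw [eq_div_iff hs.ne']
  constructor
  · rintro ⟨hK, h⟩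
    have h1 : (K * s - 1 / 2 - r) * (K * s - 1 / 2 + r) = 0 := by nlinarith
    rcases mul_eq_zero.1 h1 with h2 | h2
    · linarith
    · nlinarith [mul_pos hK hs]
  · intro h
    have hK : 0 < K := by
      by_contra hn
      nlinarith
    refine ⟨hK, ?_⟩
    have h1 : s * (s / 2 * K ^ 2 - 1 / 2 * K - s / 4) = 0 := by
      have : (K * s) ^ 2 = (1 / 2 + r) ^ 2 := by rw [h]
      nlinarith
    exact (mul_eq_zero.1 h1).resolve_left hs.ne'

/-- `L_γ = (√π / 2) K^γ`, with `K` the root above. -/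
noncomputable def constL (γ : ℝ) : ℝ := Real.sqrt Real.pi / 2 * rootK ^ γ

/-- The eight constants common to the three cases; here `γ = 2δ - 1`. -/
noncomputable def remConst (p₁ p₂ μ δ : ℝ) (u : ℝ → ℂ) : Fin 8 → ℝ :=
  let γ : ℝ := 2 * δ - 1
  let S : ℝ := linftyNorm p₁ p₂ u
  let W : ℝ := w1inftyNorm p₁ p₂ u
  ![2 ^ (2 - μ) / μ * (2 - μ) * W,
    2 ^ (1 - μ) / μ * W,
    (1 - μ) * (2 ^ (3 - μ) / 3) * S,
    constL γ / (1 - γ) * 2 ^ (2 - μ) * (1 - μ) * W,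
    constL γ / (1 - γ) * 2 ^ (1 - μ) * W,
    Real.sqrt Real.pi / 2 ^ (μ - 2) * S,
    constL γ / (1 - γ) * (1 - μ) * (p₂ - p₁) ^ (1 - γ) * W,
    constL γ / (1 - γ) * (p₂ - p₁) ^ (1 - γ) * W]

/-- The eight common blow-up exponents (powers of `(p₀ - p₁)⁻¹`); here `γ = 2δ - 1`. -/
noncomputable def remAlpha (μ δ : ℝ) : Fin 8 → ℝ :=
  let γ : ℝ := 2 * δ - 1
  ![2 - μ, 1 - μ, 4 - μ, 1 + γ - μ, γ - μ, 3 - μ, 2 - μ, 1 - μ]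

/-- The eight common decay exponents (powers of `ω⁻¹`). -/
noncomputable def remBeta (δ : ℝ) : Fin 8 → ℝ :=
  ![1, 1, 2, δ, δ, 3 / 2, δ, δ]

/-- Constants in the case `μ > 1/2`. -/
noncomputable def const₁ (p₁ p₂ μ δ : ℝ) (u : ℝ → ℂ) : Fin 9 → ℝ :=
  Matrix.vecCons (Real.Gamma μ / 2 ^ μ * linftyNorm p₁ p₂ u) (remConst p₁ p₂ μ δ u)

/-- Blow-up exponents in the case `μ > 1/2`. -/
noncomputable def alpha₁ (μ δ : ℝ) : Fin 9 → ℝ := Matrix.vecCons μ (remAlpha μ δ)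

/-- Decay exponents in the case `μ > 1/2`. -/
noncomputable def beta₁ (μ δ : ℝ) : Fin 9 → ℝ := Matrix.vecCons μ (remBeta δ)

/-- Constants in the case `μ < 1/2`. -/
noncomputable def const₃ (p₁ p₂ μ δ : ℝ) (u : ℝ → ℂ) : Fin 9 → ℝ :=
  Matrix.vecCons (Real.sqrt Real.pi * linftyNorm p₁ p₂ u) (remConst p₁ p₂ μ δ u)

/-- Blow-up exponents in the case `μ < 1/2`. -/
noncomputable def alpha₃ (μ δ : ℝ) : Fin 9 → ℝ := Matrix.vecCons (1 - μ) (remAlpha μ δ)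

/-- Decay exponents in the case `μ < 1/2`. -/
noncomputable def beta₃ (δ : ℝ) : Fin 9 → ℝ := Matrix.vecCons (1 / 2) (remBeta δ)

end OscInt

/-! The substitution `p = p₁ + d x` with `d = ω ^ (-ε)` freezes the geometry: the singularity sits
at `0`, the stationary point at `1`, and the integral becomes `d ^ μ e^{iωc}` times `∫₀^X x^{μ-1}
v(x) e^{-il(x-1)²} dx`, where `l = ω d² = ω^{1-2ε}` and `X = (p₂ - p₁) / d`. It is then enough to
expand this integral with an error explicit in `l` and `X` (`norm_integral_scaledIntegrand_sub_le`).

The rescaled integral is cut at `1/2` and at `1`. On `[0, 1/2]` the variable `s = x(2 - x) = 1 - (x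
- 1)²` makes the phase linear, and one integrates by parts against a primitive of `s^{μ-1} e^{ils}`;
on the other two pieces, against a primitive of `e^{-ils²}`. Both primitives are obtained by turning
the path of integration to a vertical ray, where the oscillation becomes the decay `e^{-lt}`; their
bounds follow from `|s + it| ≥ s` and `|s + it| ≥ t`.

The boundary terms at `0` and `1` are the main terms `K̃` and `H̃`. Those at `X` vanish because
`U(p₂) = 0`, and those at `1/2` cancel to order `1/l`, leaving `l^{-2}` and `l^{-3/2}`. Near the
stationary point the bound `1/(2sl)` on the Fresnel primitive is not integrable, so it is
interpolated with the uniform bound to get `s^{-γ}`, `γ < 1`.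

The exponents of the two main terms differ by `(μ - 1/2)(1 - 2ε)`, so the sign of `μ - 1/2` decides
which of them is dominant; the other becomes the ninth error term. -/

namespace OscInt

open MeasureTheory Set Filter Topology Complex

/-! ### Laplace integrals along vertical rays. -/

/-- The Laplace transform, at `l`, of `t ↦ (s + i t) ^ r`, an integral over a vertical ray. -/
noncomputable def rayLaplace (r l s : ℝ) : ℂ :=
  ∫ t in Ioi (0 : ℝ), ((s : ℂ) + t * I) ^ (r : ℂ) * (Real.exp (-l * t) : ℂ)

theorem ray_mem_slitPlane (s : ℝ) {t : ℝ} (ht : 0 < t) :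
    (s : ℂ) + t * I ∈ slitPlane := by
  right
  simp [ht.ne']

theorem ray_mem_slitPlane' {s t : ℝ} (hs : 0 < s) : (s : ℂ) + t * I ∈ slitPlane := by
  left
  simpa using hs

theorem le_norm_ray_left {s : ℝ} (t : ℝ) : s ≤ ‖(s : ℂ) + t * I‖ := by
  have := re_le_norm ((s : ℂ) + t * I)
  simpa using this

theorem le_norm_ray_right {s : ℝ} (t : ℝ) : t ≤ ‖(s : ℂ) + t * I‖ := by
  have := im_le_norm ((s : ℂ) + t * I)
  simpa using this

theorem norm_ray_cpow_mul_exp (r l s t : ℝ) :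
    ‖((s : ℂ) + t * I) ^ (r : ℂ) * (Real.exp (-l * t) : ℂ)‖
      = ‖(s : ℂ) + t * I‖ ^ r * Real.exp (-l * t) := by
  rw [norm_mul, norm_cpow_real, norm_real, Real.norm_of_nonneg (Real.exp_pos _).le]

theorem continuousOn_ray_integrand (r l s : ℝ) :
    ContinuousOn (fun t : ℝ => ((s : ℂ) + t * I) ^ (r : ℂ) * (Real.exp (-l * t) : ℂ))
      (Ioi 0) := by
  apply ContinuousOn.mul
  · apply ContinuousOn.cpow_const
    · fun_prop
    · intro t ht
      exact ray_mem_slitPlane _ ht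
  · fun_prop

theorem aestronglyMeasurable_ray_integrand (r l s : ℝ) :
    AEStronglyMeasurable
      (fun t : ℝ => ((s : ℂ) + t * I) ^ (r : ℂ) * (Real.exp (-l * t) : ℂ))
      (volume.restrict (Ioi 0)) :=
  (continuousOn_ray_integrand r l s).aestronglyMeasurable measurableSet_Ioi

theorem integral_exp_neg_mul_Ioi_zero {l : ℝ} (hl : 0 < l) :
    ∫ t in Ioi (0 : ℝ), Real.exp (-l * t) = 1 / l := by
  rw [integral_exp_mul_Ioi (by linarith)]
  simp

theorem integrableOn_rpow_mul_exp_neg {μ l : ℝ} (hμ : 0 < μ) (hl : 0 < l) :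
    IntegrableOn (fun t : ℝ => t ^ (μ - 1) * Real.exp (-l * t)) (Ioi 0) := by
  simpa using integrableOn_rpow_mul_exp_neg_mul_rpow (p := 1) (s := μ - 1) (b := l)
    (by linarith) one_pos hl

theorem integral_rpow_mul_exp_neg {μ l : ℝ} (hμ : 0 < μ) (hl : 0 < l) :
    ∫ t in Ioi (0 : ℝ), t ^ (μ - 1) * Real.exp (-l * t) = Real.Gamma μ * l ^ (-μ) := by
  have := Real.integral_rpow_mul_exp_neg_mul_Ioi hμ hl
  simp only [neg_mul]
  rw [this, one_div, Real.inv_rpow hl.le, Real.rpow_neg hl.le, mul_comm]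

theorem norm_ray_rpow_le {r s t : ℝ} (hr : r ≤ 0) (hs : 0 < s) :
    ‖(s : ℂ) + t * I‖ ^ r ≤ s ^ r :=
  Real.rpow_le_rpow_of_nonpos hs (le_norm_ray_left t) hr

theorem norm_ray_rpow_le' {r s t : ℝ} (hr : r ≤ 0) (ht : 0 < t) :
    ‖(s : ℂ) + t * I‖ ^ r ≤ t ^ r :=
  Real.rpow_le_rpow_of_nonpos ht (le_norm_ray_right t) hr

theorem integrableOn_ray {r l s : ℝ} (hr : r ≤ 0) (hl : 0 < l) (hs : 0 < s) :
    IntegrableOn (fun t : ℝ => ((s : ℂ) + t * I) ^ (r : ℂ) * (Real.exp (-l * t) : ℂ))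
      (Ioi 0) := by
  refine Integrable.mono' ((exp_neg_integrableOn_Ioi 0 hl).const_mul (s ^ r))
    (aestronglyMeasurable_ray_integrand r l _) (ae_of_all _ fun t => ?_)
  rw [norm_ray_cpow_mul_exp]
  exact mul_le_mul_of_nonneg_right (norm_ray_rpow_le hr hs) (Real.exp_pos _).le

theorem norm_rayLaplace_le {r l s : ℝ} (hr : r ≤ 0) (hl : 0 < l) (hs : 0 < s) :
    ‖rayLaplace r l s‖ ≤ s ^ r / l := by
  have h : ‖rayLaplace r l s‖ ≤ ∫ t in Ioi (0 : ℝ), s ^ r * Real.exp (-l * t) := by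
    refine norm_integral_le_of_norm_le ((exp_neg_integrableOn_Ioi 0 hl).const_mul (s ^ r))
      (ae_of_all _ fun t => ?_)
    rw [norm_ray_cpow_mul_exp]
    exact mul_le_mul_of_nonneg_right (norm_ray_rpow_le hr hs) (Real.exp_pos _).le
  rwa [integral_const_mul, integral_exp_neg_mul_Ioi_zero hl, mul_one_div] at h

/-- Using `|s + it| ≥ t` instead of `≥ s` gives a bound that is uniform in `s` and survives at `s =
0`. -/
theorem norm_rayLaplace_le_Gamma {μ l s : ℝ} (hμ : 0 < μ) (hμ1 : μ ≤ 1) (hl : 0 < l) :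
    ‖rayLaplace (μ - 1) l s‖ ≤ Real.Gamma μ * l ^ (-μ) := by
  rw [← integral_rpow_mul_exp_neg hμ hl]
  refine norm_integral_le_of_norm_le (integrableOn_rpow_mul_exp_neg hμ hl)
    ((ae_restrict_iff' measurableSet_Ioi).2 (ae_of_all _ fun t ht => ?_))
  rw [norm_ray_cpow_mul_exp]
  exact mul_le_mul_of_nonneg_right (norm_ray_rpow_le' (by linarith) ht) (Real.exp_pos _).le

/-- One power of `|s + it|` is bounded through `s` and the rest through `t`, since `t ^ (μ - 2)` is
not integrable at `0`. -/
theorem norm_rayLaplace_sub_two_le {μ l s : ℝ} (hμ : 0 < μ) (hμ1 : μ ≤ 1) (hl : 0 < l)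
    (hs : 0 < s) :
    ‖rayLaplace (μ - 1 - 1) l s‖ ≤ s⁻¹ * (Real.Gamma μ * l ^ (-μ)) := by
  rw [← integral_rpow_mul_exp_neg hμ hl, ← integral_const_mul]
  refine norm_integral_le_of_norm_le ((integrableOn_rpow_mul_exp_neg hμ hl).const_mul _)
    ((ae_restrict_iff' measurableSet_Ioi).2 (ae_of_all _ fun t ht => ?_))
  have hpos : 0 < ‖(s : ℂ) + t * I‖ := hs.trans_le (le_norm_ray_left t)
  rw [norm_ray_cpow_mul_exp, Real.rpow_sub_one hpos.ne' (μ - 1), ← mul_assoc]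
  refine mul_le_mul_of_nonneg_right ?_ (Real.exp_pos _).le
  rw [div_eq_inv_mul]
  exact mul_le_mul (inv_anti₀ hs (le_norm_ray_left t)) (norm_ray_rpow_le' (by linarith) ht)
    (by positivity) (by positivity)

theorem continuousOn_rayLaplace {μ l : ℝ} (hμ : 0 < μ) (hμ1 : μ ≤ 1) (hl : 0 < l) :
    ContinuousOn (rayLaplace (μ - 1) l) (Ici 0) := by
  refine continuousOn_of_dominated (bound := fun t => t ^ (μ - 1) * Real.exp (-l * t))
    (fun s hs => aestronglyMeasurable_ray_integrand _ _ _)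
    (fun s hs => (ae_restrict_iff' measurableSet_Ioi).2 (ae_of_all _ fun t ht => ?_))
    (integrableOn_rpow_mul_exp_neg hμ hl)
    ((ae_restrict_iff' measurableSet_Ioi).2 (ae_of_all _ fun t ht => ?_))
  · rw [norm_ray_cpow_mul_exp]
    exact mul_le_mul_of_nonneg_right (norm_ray_rpow_le' (by linarith) ht) (Real.exp_pos _).le
  · refine ContinuousOn.mul (ContinuousOn.cpow_const (by fun_prop) fun s hs => ?_) (by fun_prop)
    exact ray_mem_slitPlane _ ht

theorem rayLaplace_zero {μ l : ℝ} (hμ : 0 < μ) (hl : 0 < l) :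
    rayLaplace (μ - 1) l 0
      = exp (I * (Real.pi * (μ - 1) / 2)) * ((Real.Gamma μ * l ^ (-μ) : ℝ) : ℂ) := by
  rw [← integral_rpow_mul_exp_neg hμ hl, ← integral_complex_ofReal, ← integral_const_mul]
  refine setIntegral_congr_fun measurableSet_Ioi fun t ht => ?_
  have ht : 0 < t := ht
  have h1 : ((t : ℂ) * I) ≠ 0 := by simp [ht.ne']
  have h2 : ((t : ℂ) * I) ^ ((μ - 1 : ℝ) : ℂ)
      = exp (I * (Real.pi * (μ - 1) / 2)) * ((t ^ (μ - 1) : ℝ) : ℂ) := by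
    rw [cpow_def_of_ne_zero h1, log_ofReal_mul ht I_ne_zero, log_I, add_mul, exp_add,
      Real.rpow_def_of_pos ht, mul_comm]
    push_cast
    ring_nf
  simp only [ofReal_zero, zero_add, h2]
  push_cast
  ring

/-- Integration by parts along the ray. -/
theorem mul_rayLaplace_sub {r l s : ℝ} (hr : r ≤ 0) (hl : 0 < l) (hs : 0 < s) :
    l * rayLaplace r l s - ((s ^ r : ℝ) : ℂ) = I * r * rayLaplace (r - 1) l s := by
  have hder : ∀ t : ℝ, HasDerivAt
      (fun t : ℝ => ((s : ℂ) + t * I) ^ (r : ℂ) * (Real.exp (-l * t) : ℂ))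
      (I * r * (((s : ℂ) + t * I) ^ ((r - 1 : ℝ) : ℂ) * (Real.exp (-l * t) : ℂ))
        - l * (((s : ℂ) + t * I) ^ (r : ℂ) * (Real.exp (-l * t) : ℂ))) t := by
    intro t
    have h1 : HasDerivAt (fun t : ℝ => (s : ℂ) + t * I) I t := by
      have := ((ofRealCLM.hasDerivAt (x := t)).mul_const I).const_add (s : ℂ)
      simpa using this
    have h2 := HasDerivAt.comp t
      ((hasDerivAt_id ((s : ℂ) + t * I)).cpow_const (c := (r : ℂ)) (ray_mem_slitPlane' hs)) h1
    have h3 : HasDerivAt (fun t : ℝ => Real.exp (-l * t)) (Real.exp (-l * t) * (-l)) t := by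
      simpa using ((hasDerivAt_id t).const_mul (-l)).exp
    have h4 := h2.mul h3.ofReal_comp
    refine h4.congr_deriv ?_
    simp only [Function.comp_apply, id]
    push_cast
    ring
  have hi1 := (integrableOn_ray (r := r - 1) (by linarith) hl hs).const_mul (I * r)
  have hi2 := (integrableOn_ray hr hl hs).const_mul (l : ℂ)
  have hlim : Tendsto (fun t : ℝ => ((s : ℂ) + t * I) ^ (r : ℂ) * (Real.exp (-l * t) : ℂ))
      atTop (𝓝 0) := by
    have h0 : Tendsto (fun t : ℝ => s ^ r * Real.exp (-l * t)) atTop (𝓝 0) := by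
      have : Tendsto (fun t : ℝ => Real.exp (-l * t)) atTop (𝓝 0) :=
        Real.tendsto_exp_atBot.comp (tendsto_id.const_mul_atTop_of_neg (by linarith))
      simpa using this.const_mul (s ^ r)
    refine squeeze_zero_norm (fun t => ?_) h0
    rw [norm_ray_cpow_mul_exp]
    exact mul_le_mul_of_nonneg_right (norm_ray_rpow_le hr hs) (Real.exp_pos _).le
  have key := integral_Ioi_of_hasDerivAt_of_tendsto (a := 0) (hder 0).continuousAt.continuousWithinAt
    (fun t _ => hder t) (hi1.sub hi2) hlim
  rw [integral_sub hi1 hi2, integral_const_mul, integral_const_mul] at key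
  change I * r * rayLaplace (r - 1) l s - l * rayLaplace r l s = _ at key
  have : ((s : ℂ) + (0 : ℝ) * I) ^ (r : ℂ) * (Real.exp (-l * 0) : ℂ) = ((s ^ r : ℝ) : ℂ) := by
    simp [ofReal_cpow hs.le]
  rw [this] at key
  linear_combination -key

/-- Along the ray, the `t`-derivative of the power is `i` times its `s`-derivative, so integration
by parts in `t` turns differentiation in `s` into a first-order linear equation with source `s ^ r`.
-/
theorem hasDerivAt_rayLaplace {r l s : ℝ} (hr : r ≤ 0) (hl : 0 < l) (hs : 0 < s) :
    HasDerivAt (rayLaplace r l) (-I * (l * rayLaplace r l s - ((s ^ r : ℝ) : ℂ))) s := by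
  -- Restricting to `x > s / 2` keeps the ray at distance at least `s / 2` from the branch point,
  -- which gives a dominating function for the derivative.
  have h := (hasDerivAt_integral_of_dominated_loc_of_deriv_le (μ := volume.restrict (Ioi (0 : ℝ)))
    (F := fun s t : ℝ => ((s : ℂ) + t * I) ^ (r : ℂ) * (Real.exp (-l * t) : ℂ))
    (F' := fun s t : ℝ => r * (((s : ℂ) + t * I) ^ ((r - 1 : ℝ) : ℂ) * (Real.exp (-l * t) : ℂ)))
    (bound := fun t => |r| * ((s / 2) ^ (r - 1) * Real.exp (-l * t)))
    (Ioi_mem_nhds (half_lt_self hs)) ?_ (integrableOn_ray hr hl hs) ?_ ?_ ?_ ?_).2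
  · refine h.congr_deriv ?_
    rw [integral_const_mul, mul_rayLaplace_sub hr hl hs]
    change _ * rayLaplace (r - 1) l s = _
    linear_combination (r * rayLaplace (r - 1) l s) * I_mul_I
  · filter_upwards [Ioi_mem_nhds hs] with x hx
    exact aestronglyMeasurable_ray_integrand _ _ _
  · exact (aestronglyMeasurable_ray_integrand _ _ _).const_mul _
  · refine ae_of_all _ fun t x hx => ?_
    have hx' : s / 2 < x := hx
    rw [norm_mul, norm_ray_cpow_mul_exp, norm_real, Real.norm_eq_abs]
    refine mul_le_mul_of_nonneg_left (mul_le_mul_of_nonneg_right ?_ (Real.exp_pos _).le)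
      (abs_nonneg r)
    exact Real.rpow_le_rpow_of_nonpos (by linarith) (hx'.le.trans (le_norm_ray_left t))
      (by linarith)
  · exact ((exp_neg_integrableOn_Ioi 0 hl).const_mul _).const_mul _
  · refine ae_of_all _ fun t x hx => ?_
    have hx' : s / 2 < x := hx
    have h1 : HasDerivAt (fun x : ℝ => (x : ℂ) + t * I) 1 x := by
      have := (ofRealCLM.hasDerivAt (x := x)).add_const (t * I : ℂ)
      simpa using this
    have h2 := HasDerivAt.comp x
      ((hasDerivAt_id ((x : ℂ) + t * I)).cpow_const (c := (r : ℂ))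
        (ray_mem_slitPlane' (by linarith))) h1
    refine (h2.mul_const _).congr_deriv ?_
    simp only [id]
    push_cast
    ring

/-! ### Primitives of the oscillating factors. -/

/-- The primitive of `s ^ (μ - 1) * exp (i l s)` on `(0, ∞)` that vanishes at infinity. -/
noncomputable def powPrimitive (μ l s : ℝ) : ℂ :=
  -I * exp (I * l * s) * rayLaplace (μ - 1) l s

theorem norm_exp_I_mul_ofReal_mul (l s : ℝ) : ‖exp (I * l * s)‖ = 1 := by
  have : I * l * s = ((l * s : ℝ) : ℂ) * I := by push_cast; ring
  rw [this, norm_exp_ofReal_mul_I]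

theorem norm_powPrimitive (μ l s : ℝ) : ‖powPrimitive μ l s‖ = ‖rayLaplace (μ - 1) l s‖ := by
  simp only [powPrimitive, norm_mul, norm_neg, norm_I, norm_exp_I_mul_ofReal_mul, one_mul]

/-- The factor `exp (i l s)` absorbs the homogeneous part of the equation for `rayLaplace`; only the
source term remains. -/
theorem hasDerivAt_powPrimitive {μ l s : ℝ} (hμ1 : μ ≤ 1) (hl : 0 < l) (hs : 0 < s) :
    HasDerivAt (powPrimitive μ l) (((s ^ (μ - 1) : ℝ) : ℂ) * exp (I * l * s)) s := by
  have h1 : HasDerivAt (fun s : ℝ => exp (I * l * s)) (exp (I * l * s) * (I * l)) s := by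
    have := ((ofRealCLM.hasDerivAt (x := s)).const_mul (I * l : ℂ)).cexp
    simpa using this
  refine ((h1.const_mul (-I)).mul (hasDerivAt_rayLaplace (r := μ - 1) (by linarith) hl hs)).congr_deriv
    ?_
  linear_combination (-((s ^ (μ - 1) : ℝ) : ℂ) * exp (I * l * s)) * I_mul_I

theorem continuousOn_powPrimitive {μ l : ℝ} (hμ : 0 < μ) (hμ1 : μ ≤ 1) (hl : 0 < l) :
    ContinuousOn (powPrimitive μ l) (Ici 0) :=
  ContinuousOn.mul (by fun_prop) (continuousOn_rayLaplace hμ hμ1 hl)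

theorem powPrimitive_zero {μ l : ℝ} (hμ : 0 < μ) (hl : 0 < l) :
    powPrimitive μ l 0 = -exp (I * (Real.pi * μ / 2)) * ((Real.Gamma μ * l ^ (-μ) : ℝ) : ℂ) := by
  rw [powPrimitive, rayLaplace_zero hμ hl]
  have : exp (I * (Real.pi * μ / 2)) = I * exp (I * (Real.pi * (μ - 1) / 2)) := by
    have h : I * (Real.pi * μ / 2 : ℂ) = Real.pi / 2 * I + I * (Real.pi * (μ - 1) / 2) := by ring
    rw [h, exp_add, exp_pi_div_two_mul_I]
  rw [this]
  simp
  ring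

/-- The primitive of `exp (-i l s²)` on `(0, ∞)` that vanishes at infinity. -/
noncomputable def fresnelPrimitive (l s : ℝ) : ℂ :=
  (starRingEnd ℂ) (powPrimitive (1 / 2) l (s ^ 2)) / 2

theorem sq_rpow_half_sub_one {s : ℝ} (hs : 0 < s) : (s ^ 2) ^ ((1 : ℝ) / 2 - 1) = s⁻¹ := by
  rw [← Real.rpow_natCast s 2, ← Real.rpow_mul hs.le]
  norm_num
  exact Real.rpow_neg_one s

/-- With `μ = 1/2` and argument `s²`, the Jacobian `2 s` cancels `(s²)^{-1/2}` up to the factor `2`;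
conjugation reverses the sign of the phase. -/
theorem hasDerivAt_fresnelPrimitive {l s : ℝ} (hl : 0 < l) (hs : 0 < s) :
    HasDerivAt (fresnelPrimitive l) (exp (-(I * l * (s ^ 2 : ℝ)))) s := by
  have h := HasDerivAt.scomp (h := fun s : ℝ => s ^ 2) s
    (hasDerivAt_powPrimitive (μ := 1 / 2) (by norm_num) hl (pow_pos hs 2)) (hasDerivAt_pow 2 s)
  have h2 := ((conjCLE : ℂ →L[ℝ] ℂ).hasFDerivAt.comp_hasDerivAt s h).div_const 2
  refine HasDerivAt.congr_deriv h2 ?_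
  have hs' : (s : ℂ) ≠ 0 := by exact_mod_cast hs.ne'
  simp only [sq_rpow_half_sub_one hs]
  simp [← exp_conj, map_ofNat]
  field_simp

theorem continuous_fresnelPrimitive {l : ℝ} (hl : 0 < l) :
    Continuous (fresnelPrimitive l) := by
  have h : Continuous fun s : ℝ => powPrimitive (1 / 2) l (s ^ 2) := by
    rw [← continuousOn_univ]
    exact (continuousOn_powPrimitive (by norm_num) (by norm_num) hl).comp (by fun_prop)
      fun s _ => sq_nonneg s
  exact (continuous_conj.comp h).div_const 2

theorem norm_fresnelPrimitive (l s : ℝ) :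
    ‖fresnelPrimitive l s‖ = ‖rayLaplace (1 / 2 - 1) l (s ^ 2)‖ / 2 := by
  rw [fresnelPrimitive, norm_div, RCLike.norm_conj, norm_powPrimitive]
  norm_num

theorem fresnelPrimitive_zero {l : ℝ} (hl : 0 < l) :
    -(2 * fresnelPrimitive l 0) = (Real.sqrt Real.pi : ℂ) * exp (-(I * (Real.pi / 4)))
      * ((l ^ (-(1 / 2) : ℝ) : ℝ) : ℂ) := by
  rw [fresnelPrimitive, zero_pow two_ne_zero, powPrimitive_zero (by norm_num) hl,
    Real.Gamma_one_half_eq]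
  simp only [map_mul, map_neg, ← exp_conj, conj_ofReal, conj_I, map_div₀, map_ofNat]
  push_cast
  simp
  ring_nf

/-- The only property of the root that the estimates need. After squaring it amounts to `√π ≤ 2`. -/
theorem one_le_rootK : 1 ≤ rootK := by
  have hs : 0 < Real.sqrt Real.pi := Real.sqrt_pos.2 Real.pi_pos
  have hs2 : Real.sqrt Real.pi ^ 2 = Real.pi := Real.sq_sqrt Real.pi_pos.le
  have hr2 : Real.sqrt (1 / 4 + Real.pi / 2) ^ 2 = 1 / 4 + Real.pi / 2 :=
    Real.sq_sqrt (by positivity)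
  have h0 := Real.sqrt_nonneg (1 / 4 + Real.pi / 2)
  have hpi := Real.pi_lt_four
  unfold rootK
  rw [le_div_iff₀ hs, one_mul]
  have hs4 : Real.sqrt Real.pi ≤ 2 := by nlinarith
  by_contra hc
  nlinarith

/-- Interpolation between the two bounds `1 / (2 s l)` and `√π / (2 √l)`. -/
theorem norm_fresnelPrimitive_le {γ l s : ℝ} (hγ : 0 ≤ γ) (hγ1 : γ ≤ 1) (hl : 0 < l)
    (hs : 0 < s) :
    ‖fresnelPrimitive l s‖ ≤ constL γ * l ^ (-((1 + γ) / 2)) * s ^ (-γ) := by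
  rw [norm_fresnelPrimitive]
  set N := ‖rayLaplace (1 / 2 - 1) l (s ^ 2)‖ with hN
  have hN0 : 0 ≤ N := norm_nonneg _
  have h1 : N ≤ s⁻¹ * l⁻¹ := by
    have := norm_rayLaplace_le (r := 1 / 2 - 1) (by norm_num) hl (pow_pos hs 2)
    rwa [sq_rpow_half_sub_one hs, div_eq_mul_inv] at this
  have h2 : N ≤ Real.sqrt Real.pi * l ^ (-(1 / 2) : ℝ) := by
    have := norm_rayLaplace_le_Gamma (μ := 1 / 2) (s := s ^ 2) (by norm_num) (by norm_num) hl
    rwa [Real.Gamma_one_half_eq] at this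
  have h3 : N ≤ (s⁻¹ * l⁻¹) ^ γ * (Real.sqrt Real.pi * l ^ (-(1 / 2) : ℝ)) ^ (1 - γ) := by
    rcases hN0.eq_or_lt with h | h
    · rw [← h]; positivity
    · calc N = N ^ γ * N ^ (1 - γ) := by rw [← Real.rpow_add h]; simp
        _ ≤ _ := by gcongr
  have hsp : 1 ≤ Real.sqrt Real.pi := by
    rw [Real.one_le_sqrt]; linarith [Real.pi_gt_three]
  have h4 : (s⁻¹ * l⁻¹) ^ γ * (Real.sqrt Real.pi * l ^ (-(1 / 2) : ℝ)) ^ (1 - γ)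
      = Real.sqrt Real.pi ^ (1 - γ) * (l ^ (-((1 + γ) / 2)) * s ^ (-γ)) := by
    rw [Real.mul_rpow (by positivity) (by positivity), Real.mul_rpow (by positivity) (by positivity),
      Real.inv_rpow hs.le, Real.inv_rpow hl.le, ← Real.rpow_neg hs.le, ← Real.rpow_neg hl.le,
      ← Real.rpow_mul hl.le]
    have : l ^ (-((1 + γ) / 2)) = l ^ (-γ) * l ^ (-(1 / 2) * (1 - γ)) := by
      rw [← Real.rpow_add hl]; ring_nf
    rw [this]; ring
  -- Interpolation produces the constant `√π ^ (1 - γ) / 2`; as `√π ≥ 1` and `K ≥ 1`, it is at most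
  -- `L_γ`.
  have h5 : Real.sqrt Real.pi ^ (1 - γ) ≤ Real.sqrt Real.pi * rootK ^ γ := by
    have h6 : Real.sqrt Real.pi ^ (1 - γ) ≤ Real.sqrt Real.pi := by
      simpa using Real.rpow_le_rpow_of_exponent_le hsp (show 1 - γ ≤ 1 by linarith)
    have h7 := Real.one_le_rpow one_le_rootK hγ
    nlinarith
  rw [h4] at h3
  have h8 := h3.trans (mul_le_mul_of_nonneg_right h5 (by positivity))
  rw [constL]
  linarith

/-- One integration by parts along the ray isolates the `1/l` term, with an exact remainder. It is
applied at the cut, where these leading terms cancel. -/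
theorem powPrimitive_sub {μ l s : ℝ} (hμ1 : μ ≤ 1) (hl : 0 < l) (hs : 0 < s) :
    ‖powPrimitive μ l s - -I * exp (I * l * s) * ((s ^ (μ - 1) / l : ℝ) : ℂ)‖
      = (1 - μ) * ‖rayLaplace (μ - 1 - 1) l s‖ / l := by
  have h := mul_rayLaplace_sub (r := μ - 1) (by linarith) hl hs
  have hl' : (l : ℂ) ≠ 0 := by exact_mod_cast hl.ne'
  have h2 : powPrimitive μ l s - -I * exp (I * l * s) * ((s ^ (μ - 1) / l : ℝ) : ℂ)
      = -I * exp (I * l * s) * (I * ((μ - 1 : ℝ) : ℂ) * rayLaplace (μ - 1 - 1) l s) / l := by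
    rw [← h, powPrimitive]
    push_cast
    field_simp
    ring
  rw [h2]
  simp only [norm_mul, norm_div, norm_neg, norm_I, norm_exp_I_mul_ofReal_mul, norm_real, one_mul,
    Real.norm_eq_abs, abs_of_pos hl]
  rw [abs_of_nonpos (by linarith)]
  ring

theorem norm_powPrimitive_sub_le {μ l s : ℝ} (hμ1 : μ ≤ 1) (hl : 0 < l) (hs : 0 < s) :
    ‖powPrimitive μ l s - -I * exp (I * l * s) * ((s ^ (μ - 1) / l : ℝ) : ℂ)‖
      ≤ (1 - μ) * s ^ (μ - 1 - 1) / l ^ 2 := by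
  rw [powPrimitive_sub hμ1 hl hs]
  have := norm_rayLaplace_le (r := μ - 1 - 1) (by linarith) hl hs
  calc (1 - μ) * ‖rayLaplace (μ - 1 - 1) l s‖ / l
      ≤ (1 - μ) * (s ^ (μ - 1 - 1) / l) / l := by
        gcongr
    _ = _ := by field_simp

theorem norm_fresnelPrimitive_half_sub_le {l : ℝ} (hl : 0 < l) :
    ‖fresnelPrimitive l (1 / 2) - I * exp (-(I * l * (1 / 4))) / l‖
      ≤ Real.sqrt Real.pi * l ^ (-(3 / 2) : ℝ) := by
  have h1 := powPrimitive_sub (μ := 1 / 2) (by norm_num) hl (show (0 : ℝ) < (1 / 2) ^ 2 by norm_num)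
  have h2 := norm_rayLaplace_sub_two_le (μ := 1 / 2) (by norm_num) (by norm_num) hl
    (show (0 : ℝ) < (1 / 2) ^ 2 by norm_num)
  rw [sq_rpow_half_sub_one (by norm_num)] at h1
  rw [Real.Gamma_one_half_eq] at h2
  have h3 : fresnelPrimitive l (1 / 2) - I * exp (-(I * l * (1 / 4))) / l
      = (starRingEnd ℂ) (powPrimitive (1 / 2) l ((1 / 2) ^ 2)
        - -I * exp (I * l * (((1 / 2) ^ 2 : ℝ) : ℂ)) * (((1 / 2 : ℝ)⁻¹ / l : ℝ) : ℂ)) / 2 := by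
    rw [fresnelPrimitive]
    simp [← exp_conj, map_ofNat]
    ring_nf
  rw [h3, norm_div, RCLike.norm_conj, h1]
  have h4 : l ^ (-(3 / 2) : ℝ) = l ^ (-(1 / 2) : ℝ) / l := by
    rw [← Real.rpow_sub_one hl.ne']
    norm_num
  rw [h4]
  calc (1 - 1 / 2) * ‖rayLaplace (1 / 2 - 1 - 1) l ((1 / 2) ^ 2)‖ / l / ‖(2 : ℂ)‖
      ≤ (1 - 1 / 2) * (((1 / 2 : ℝ) ^ 2)⁻¹ * (Real.sqrt Real.pi * l ^ (-(1 / 2) : ℝ))) / l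
        / ‖(2 : ℂ)‖ := by gcongr
    _ = _ := by
      rw [Complex.norm_ofNat]
      ring

/-! ### Integration by parts on the three pieces. -/

/-- Derivatives and the majorant `B` are only constrained inside the interval, so `B` may have an
integrable singularity at an endpoint: at `0` for the singular piece, at `1` for the other two. -/
theorem norm_integral_mul_deriv_sub_le {a b : ℝ} (hab : a ≤ b) {A A' F F' : ℝ → ℂ} {B : ℝ → ℝ}
    (hA : ContinuousOn A (Icc a b)) (hF : ContinuousOn F (Icc a b))
    (hA' : ∀ x ∈ Ioo a b, HasDerivAt A (A' x) x) (hF' : ∀ x ∈ Ioo a b, HasDerivAt F (F' x) x)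
    (iA : IntervalIntegrable A' volume a b) (iF : IntervalIntegrable F' volume a b)
    (hB : ∀ x ∈ Ioo a b, ‖A' x‖ * ‖F x‖ ≤ B x) (iB : IntervalIntegrable B volume a b) :
    ‖(∫ x in a..b, A x * F' x) - (A b * F b - A a * F a)‖ ≤ ∫ x in a..b, B x := by
  rw [intervalIntegral.integral_mul_deriv_eq_deriv_mul_of_hasDeriv_right
    (by rwa [uIcc_of_le hab]) (by rwa [uIcc_of_le hab])
    (by rw [min_eq_left hab, max_eq_right hab]; exact fun x hx => (hA' x hx).hasDerivWithinAt)
    (by rw [min_eq_left hab, max_eq_right hab]; exact fun x hx => (hF' x hx).hasDerivWithinAt)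
    iA iF, sub_sub_cancel_left, norm_neg]
  refine intervalIntegral.norm_integral_le_of_norm_le hab ?_ iB
  filter_upwards [Measure.ae_ne volume b] with x hx hx2
  rw [norm_mul]
  exact hB x ⟨hx2.1, lt_of_le_of_ne hx2.2 hx⟩

theorem intervalIntegrable_rpow_ofReal {r : ℝ} (hr : -1 < r) (a b : ℝ) :
    IntervalIntegrable (fun x : ℝ => ((x ^ r : ℝ) : ℂ)) volume a b :=
  ⟨(intervalIntegral.intervalIntegrable_rpow' hr).1.ofReal,
    (intervalIntegral.intervalIntegrable_rpow' hr).2.ofReal⟩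

/-- The integrand on the rescaled interval, with singularity at `0` and stationary point `1`. -/
noncomputable def scaledIntegrand (μ l : ℝ) (v : ℝ → ℂ) (x : ℝ) : ℂ :=
  ((x ^ (μ - 1) : ℝ) : ℂ) * v x * exp (-(I * l * ((x - 1) ^ 2 : ℝ)))

section Amplitude

variable {X μ l S W : ℝ} {v v' : ℝ → ℂ}

theorem hasDerivAt_rpow_smul {x : ℝ} (hx : 0 < x) (hv : HasDerivAt v (v' x) x) :
    HasDerivAt (fun x => ((x ^ (μ - 1) : ℝ) : ℂ) * v x)
      ((((μ - 1) * x ^ (μ - 1 - 1) : ℝ) : ℂ) * v x + ((x ^ (μ - 1) : ℝ) : ℂ) * v' x) x :=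
  (Real.hasDerivAt_rpow_const (Or.inl hx.ne')).ofReal_comp.mul hv

theorem norm_deriv_rpow_smul_le {x a : ℝ} (ha : 0 < a) (hax : a ≤ x) (hμ1 : μ ≤ 1)
    (hS : ‖v x‖ ≤ S) (hW : ‖v' x‖ ≤ W) :
    ‖(((μ - 1) * x ^ (μ - 1 - 1) : ℝ) : ℂ) * v x + ((x ^ (μ - 1) : ℝ) : ℂ) * v' x‖
      ≤ (1 - μ) * a ^ (μ - 1 - 1) * S + a ^ (μ - 1) * W := by
  have hx : 0 < x := ha.trans_le hax
  refine (norm_add_le _ _).trans ?_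
  rw [norm_mul, norm_mul, norm_real, norm_real, norm_mul, Real.norm_of_nonpos (by linarith : μ - 1 ≤ 0),
    Real.norm_of_nonneg (by positivity : 0 ≤ x ^ (μ - 1 - 1)),
    Real.norm_of_nonneg (by positivity : 0 ≤ x ^ (μ - 1))]
  have h1 : x ^ (μ - 1 - 1) ≤ a ^ (μ - 1 - 1) :=
    Real.rpow_le_rpow_of_nonpos ha hax (by linarith)
  have h2 : x ^ (μ - 1) ≤ a ^ (μ - 1) := Real.rpow_le_rpow_of_nonpos ha hax (by linarith)
  have h3 : 0 ≤ 1 - μ := by linarith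
  have h4 : -(μ - 1) = 1 - μ := by ring
  rw [h4]
  gcongr

theorem continuousOn_rpow_smul {a b r : ℝ} (ha : 0 < a) {w : ℝ → ℂ}
    (hw : ContinuousOn w (Icc a b)) :
    ContinuousOn (fun x => ((x ^ r : ℝ) : ℂ) * w x) (Icc a b) := by
  refine ContinuousOn.mul ?_ hw
  exact continuous_ofReal.comp_continuousOn
    (continuousOn_id.rpow_const fun x hx => Or.inl (ha.trans_le hx.1).ne')

theorem continuousOn_deriv_rpow_smul {a b : ℝ} (ha : 0 < a) (hv : ContinuousOn v (Icc a b))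
    (hv' : ContinuousOn v' (Icc a b)) :
    ContinuousOn (fun x => (((μ - 1) * x ^ (μ - 1 - 1) : ℝ) : ℂ) * v x
      + ((x ^ (μ - 1) : ℝ) : ℂ) * v' x) (Icc a b) := by
  refine ContinuousOn.add ?_ (continuousOn_rpow_smul ha hv')
  refine ((continuousOn_rpow_smul (r := μ - 1 - 1) ha hv).const_mul ((μ - 1 : ℝ) : ℂ)).congr
    fun x _ => ?_
  push_cast
  ring

/-- The part of the integral between the cut and the stationary point. -/
theorem norm_integral_left_of_stationary_sub_le {γ : ℝ} (hμ1 : μ ≤ 1) (hl : 0 < l) (hγ : 0 ≤ γ)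
    (hγ1 : γ < 1) (hv : ContinuousOn v (Icc (1 / 2) 1)) (hv' : ContinuousOn v' (Icc (1 / 2) 1))
    (hd : ∀ x ∈ Ioo (1 / 2 : ℝ) 1, HasDerivAt v (v' x) x)
    (hS : ∀ x ∈ Ioo (1 / 2 : ℝ) 1, ‖v x‖ ≤ S) (hW : ∀ x ∈ Ioo (1 / 2 : ℝ) 1, ‖v' x‖ ≤ W)
    (hS0 : 0 ≤ S) (hW0 : 0 ≤ W) :
    ‖(∫ x in (1 / 2 : ℝ)..1, scaledIntegrand μ l v x)
      - (((2 ^ (1 - μ) : ℝ) : ℂ) * v (1 / 2) * fresnelPrimitive l (1 / 2)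
        - v 1 * fresnelPrimitive l 0)‖
      ≤ ((1 - μ) * 2 ^ (2 - μ) * S + 2 ^ (1 - μ) * W)
        * (constL γ * l ^ (-((1 + γ) / 2)) / (1 - γ)) := by
  set C := (1 - μ) * (1 / 2 : ℝ) ^ (μ - 1 - 1) * S + (1 / 2 : ℝ) ^ (μ - 1) * W with hC
  have hC0 : 0 ≤ C := by
    have : 0 ≤ 1 - μ := by linarith
    positivity
  have hL : 0 ≤ constL γ := by
    have := one_le_rootK
    unfold constL
    positivity
  set D := constL γ * l ^ (-((1 + γ) / 2)) with hD
  have hD0 : 0 ≤ D := by positivity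
  -- The phase is even about `1`, so the Fresnel primitive is reflected: this explains the argument
  -- `1 - x` and the sign.
  have key := norm_integral_mul_deriv_sub_le (a := 1 / 2) (b := 1) (by norm_num)
    (A := fun x => ((x ^ (μ - 1) : ℝ) : ℂ) * v x)
    (F := fun x => -fresnelPrimitive l (1 - x))
    (F' := fun x => exp (-(I * l * ((x - 1) ^ 2 : ℝ))))
    (B := fun x => C * (D * (1 - x) ^ (-γ)))
    (continuousOn_rpow_smul (by norm_num) hv)
    (((continuous_fresnelPrimitive hl).comp (by fun_prop : Continuous fun x : ℝ => 1 - x)).neg.continuousOn)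
    (fun x hx => hasDerivAt_rpow_smul (by linarith [hx.1]) (hd x hx))
    (fun x hx => ?_)
    (ContinuousOn.intervalIntegrable_of_Icc (by norm_num)
      (continuousOn_deriv_rpow_smul (by norm_num) hv hv'))
    (Continuous.intervalIntegrable (by fun_prop) _ _)
    (fun x hx => ?_) ?_
  · have hint : ∫ x in (1 / 2 : ℝ)..1, C * (D * (1 - x) ^ (-γ))
        = C * (D * ((1 / 2) ^ (1 - γ) / (1 - γ))) := by
      rw [intervalIntegral.integral_const_mul, intervalIntegral.integral_const_mul,
        intervalIntegral.integral_comp_sub_left (fun x => x ^ (-γ)), integral_rpow (by left; linarith)]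
      rw [sub_self, Real.zero_rpow (by linarith), sub_zero]
      norm_num
      left; left
      rw [neg_add_eq_sub]
    have hp1 : (1 / 2 : ℝ) ^ (μ - 1) = 2 ^ (1 - μ) := by
      rw [one_div, Real.inv_rpow (by norm_num), ← Real.rpow_neg (by norm_num), neg_sub]
    have hp2 : (1 / 2 : ℝ) ^ (μ - 1 - 1) = 2 ^ (2 - μ) := by
      rw [one_div, Real.inv_rpow (by norm_num), ← Real.rpow_neg (by norm_num)]
      ring_nf
    rw [hint] at key
    simp only [sub_self, Real.one_rpow, ofReal_one, one_mul, hp1] at key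
    have e1 : (1 : ℝ) - 1 / 2 = 1 / 2 := by norm_num
    rw [e1] at key
    rw [hp1, hp2] at hC
    rw [← hC]
    have hle : C * (D * ((1 / 2) ^ (1 - γ) / (1 - γ))) ≤ C * (D / (1 - γ)) := by
      have h1 : (1 / 2 : ℝ) ^ (1 - γ) ≤ 1 :=
        Real.rpow_le_one (by norm_num) (by norm_num) (by linarith)
      have h2 : 0 < 1 - γ := by linarith
      refine mul_le_mul_of_nonneg_left ?_ hC0
      rw [mul_div_assoc']
      gcongr
      nlinarith
    refine le_trans (le_of_eq ?_) (key.trans hle)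
    congr 1
    simp only [scaledIntegrand]
    ring
  · have h := (hasDerivAt_fresnelPrimitive hl (s := 1 - x) (by linarith [hx.2])).scomp x
      ((hasDerivAt_id x).const_sub 1)
    refine h.neg.congr_deriv ?_
    simp only [neg_smul, one_smul, neg_neg]
    congr 4
    ring
  · have h1 := norm_deriv_rpow_smul_le (μ := μ) (by norm_num) hx.1.le hμ1 (hS x hx) (hW x hx)
    have h2 := norm_fresnelPrimitive_le hγ hγ1.le hl (s := 1 - x) (by linarith [hx.2])
    rw [norm_neg]
    exact mul_le_mul h1 h2 (norm_nonneg _) hC0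
  · refine (IntervalIntegrable.const_mul ?_ D).const_mul C
    have := (intervalIntegral.intervalIntegrable_rpow' (a := 1 / 2) (b := 0) (r := -γ)
      (by linarith)).comp_sub_left 1
    norm_num at this ⊢
    exact this

/-- The part of the integral to the right of the stationary point. -/
theorem norm_integral_right_of_stationary_sub_le {γ : ℝ} (hμ1 : μ ≤ 1) (hl : 0 < l) (hγ : 0 ≤ γ)
    (hγ1 : γ < 1) (hX : 1 ≤ X) (hv : ContinuousOn v (Icc 1 X)) (hv' : ContinuousOn v' (Icc 1 X))
    (hd : ∀ x ∈ Ioo 1 X, HasDerivAt v (v' x) x)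
    (hS : ∀ x ∈ Ioo 1 X, ‖v x‖ ≤ S) (hW : ∀ x ∈ Ioo 1 X, ‖v' x‖ ≤ W)
    (hS0 : 0 ≤ S) (hW0 : 0 ≤ W) (hvX : v X = 0) :
    ‖(∫ x in (1 : ℝ)..X, scaledIntegrand μ l v x) + v 1 * fresnelPrimitive l 0‖
      ≤ ((1 - μ) * S + W) * (constL γ * l ^ (-((1 + γ) / 2)) / (1 - γ)) * X ^ (1 - γ) := by
  set C := (1 - μ) * (1 : ℝ) ^ (μ - 1 - 1) * S + (1 : ℝ) ^ (μ - 1) * W with hC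
  have hC0 : 0 ≤ C := by
    have : 0 ≤ 1 - μ := by linarith
    positivity
  have hL : 0 ≤ constL γ := by
    have := one_le_rootK
    unfold constL
    positivity
  set D := constL γ * l ^ (-((1 + γ) / 2)) with hD
  have hD0 : 0 ≤ D := by positivity
  have key := norm_integral_mul_deriv_sub_le (a := 1) (b := X) hX
    (A := fun x => ((x ^ (μ - 1) : ℝ) : ℂ) * v x)
    (F := fun x => fresnelPrimitive l (x - 1))
    (F' := fun x => exp (-(I * l * ((x - 1) ^ 2 : ℝ))))
    (B := fun x => C * (D * (x - 1) ^ (-γ)))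
    (continuousOn_rpow_smul (by norm_num) hv)
    (((continuous_fresnelPrimitive hl).comp (by fun_prop : Continuous fun x : ℝ => x - 1)).continuousOn)
    (fun x hx => hasDerivAt_rpow_smul (by linarith [hx.1]) (hd x hx))
    (fun x hx => ?_)
    (ContinuousOn.intervalIntegrable_of_Icc hX
      (continuousOn_deriv_rpow_smul (by norm_num) hv hv'))
    (Continuous.intervalIntegrable (by fun_prop) _ _)
    (fun x hx => ?_) ?_
  · have hint : ∫ x in (1 : ℝ)..X, C * (D * (x - 1) ^ (-γ))
        = C * (D * ((X - 1) ^ (1 - γ) / (1 - γ))) := by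
      rw [intervalIntegral.integral_const_mul, intervalIntegral.integral_const_mul,
        intervalIntegral.integral_comp_sub_right (fun x => x ^ (-γ)), integral_rpow (by left; linarith)]
      rw [sub_self, Real.zero_rpow (by linarith), sub_zero, neg_add_eq_sub]
    rw [hint] at key
    simp only [Real.one_rpow, mul_one, one_mul] at hC
    simp only [sub_self, Real.one_rpow, ofReal_one, one_mul, hvX, mul_zero, zero_mul,
      zero_sub, sub_neg_eq_add] at key
    rw [← hC]
    -- Enlarging `X - 1` to `X` makes the bound a pure power of `(p₂ - p₁) / d`.
    have hle : C * (D * ((X - 1) ^ (1 - γ) / (1 - γ))) ≤ C * (D / (1 - γ)) * X ^ (1 - γ) := by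
      have h1 : (X - 1) ^ (1 - γ) ≤ X ^ (1 - γ) :=
        Real.rpow_le_rpow (by linarith) (by linarith) (by linarith)
      have h2 : 0 < 1 - γ := by linarith
      calc C * (D * ((X - 1) ^ (1 - γ) / (1 - γ)))
          ≤ C * (D * (X ^ (1 - γ) / (1 - γ))) := by gcongr
        _ = _ := by ring
    exact key.trans hle
  · have h := (hasDerivAt_fresnelPrimitive hl (s := x - 1) (by linarith [hx.1])).scomp x
      ((hasDerivAt_id x).sub_const 1)
    refine h.congr_deriv ?_
    simp only [one_smul]
  · have h1 := norm_deriv_rpow_smul_le (μ := μ) (by norm_num) hx.1.le hμ1 (hS x hx) (hW x hx)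
    have h2 := norm_fresnelPrimitive_le hγ hγ1.le hl (s := x - 1) (by linarith [hx.1])
    exact mul_le_mul h1 h2 (norm_nonneg _) hC0
  · refine (IntervalIntegrable.const_mul ?_ D).const_mul C
    have := (intervalIntegral.intervalIntegrable_rpow' (a := 0) (b := X - 1) (r := -γ)
      (by linarith)).comp_sub_right 1
    norm_num at this ⊢
    exact this

/-- The weight turning `x ^ (μ - 1)` into `(s ^ (μ - 1)) * s'`, where `s = x * (2 - x)`. -/
noncomputable def substWeight (μ x : ℝ) : ℝ := (2 - x) ^ (1 - μ) / (2 * (1 - x))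

/-- The derivative of `substWeight`. -/
noncomputable def substWeightDeriv (μ x : ℝ) : ℝ :=
  substWeight μ x * ((1 + μ * (1 - x)) / ((1 - x) * (2 - x)))

theorem hasDerivAt_substWeight {x : ℝ} (hx : x < 1) :
    HasDerivAt (substWeight μ) (substWeightDeriv μ x) x := by
  have h1 : HasDerivAt (fun x : ℝ => 2 - x) (-1) x := by
    simpa using (hasDerivAt_id x).const_sub 2
  have h2 : HasDerivAt (fun x : ℝ => 2 * (1 - x)) (-2) x := by
    simpa using ((hasDerivAt_id x).const_sub 1).const_mul 2
  have h3 := (h1.rpow_const (p := 1 - μ) (Or.inl (by linarith))).div h2 (by linarith)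
  refine h3.congr_deriv ?_
  have e1 : 2 - x ≠ 0 := by linarith
  have e2 : 1 - x ≠ 0 := by linarith
  rw [Real.rpow_sub_one e1, substWeightDeriv, substWeight]
  field_simp
  ring

theorem continuousOn_substWeight : ContinuousOn (substWeight μ) (Icc 0 (1 / 2)) :=
  fun x hx => (hasDerivAt_substWeight (by linarith [hx.2])).continuousAt.continuousWithinAt

theorem continuousOn_substWeightDeriv : ContinuousOn (substWeightDeriv μ) (Icc 0 (1 / 2)) := by
  refine continuousOn_substWeight.mul (ContinuousOn.div (by fun_prop) (by fun_prop) fun x hx => ?_)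
  have h1 : 0 < 1 - x := by linarith [hx.2]
  have h2 : 0 < 2 - x := by linarith [hx.2]
  positivity

theorem substWeight_mul {x : ℝ} (hx : x < 1) :
    substWeight μ x * (2 - x) ^ (μ - 1) = 1 / (2 * (1 - x)) := by
  have h : (2 - x) ^ (1 - μ) * (2 - x) ^ (μ - 1) = 1 := by
    rw [← Real.rpow_add (by linarith)]
    simp
  rw [substWeight, div_mul_eq_mul_div, h]

/-- The part of the integral next to the singularity. -/
theorem norm_integral_singular_sub_le (hμ : 0 < μ) (hμ1 : μ < 1) (hl : 0 < l)
    (hv : ContinuousOn v (Icc 0 (1 / 2))) (hv' : ContinuousOn v' (Icc 0 (1 / 2)))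
    (hd : ∀ x ∈ Ioo (0 : ℝ) (1 / 2), HasDerivAt v (v' x) x)
    (hS : ∀ x ∈ Ioo (0 : ℝ) (1 / 2), ‖v x‖ ≤ S) (hW : ∀ x ∈ Ioo (0 : ℝ) (1 / 2), ‖v' x‖ ≤ W)
    (hS0 : 0 ≤ S) (hW0 : 0 ≤ W) :
    ‖(∫ x in (0 : ℝ)..(1 / 2), scaledIntegrand μ l v x)
      - exp (-(I * l)) * (((substWeight μ (1 / 2) : ℝ) : ℂ) * v (1 / 2) * powPrimitive μ l (3 / 4)
        - ((substWeight μ 0 : ℝ) : ℂ) * v 0 * powPrimitive μ l 0)‖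
      ≤ (2 ^ (2 - μ) / μ * (2 - μ) * S + 2 ^ (1 - μ) / μ * W) * l⁻¹ := by
  have hrpow : ∀ x ∈ Icc (0 : ℝ) (1 / 2),
      (x * (2 - x)) ^ (μ - 1) = x ^ (μ - 1) * (2 - x) ^ (μ - 1) := fun x hx =>
    Real.mul_rpow hx.1 (by linarith [hx.2])
  have key := norm_integral_mul_deriv_sub_le (a := 0) (b := 1 / 2) (by norm_num)
    (A := fun x => ((substWeight μ x : ℝ) : ℂ) * v x)
    (A' := fun x => ((substWeightDeriv μ x : ℝ) : ℂ) * v x + ((substWeight μ x : ℝ) : ℂ) * v' x)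
    (F := fun x => exp (-(I * l)) * powPrimitive μ l (x * (2 - x)))
    (F' := fun x => ((x ^ (μ - 1) : ℝ) : ℂ) * ((((2 - x) ^ (μ - 1) * (2 * (1 - x)) : ℝ) : ℂ)
      * exp (-(I * l * ((x - 1) ^ 2 : ℝ)))))
    -- `(4 + 2 * μ) / 3` bounds the logarithmic derivative of `substWeight` on `[0, 1/2]`; it is the
    -- value at `x = 1/2`.
    (B := fun x => x ^ (μ - 1) * (((4 + 2 * μ) / 3 * S + W) * l⁻¹))
    (ContinuousOn.mul (continuous_ofReal.comp_continuousOn continuousOn_substWeight) hv)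
    (ContinuousOn.mul continuousOn_const
      ((continuousOn_powPrimitive hμ hμ1.le hl).comp (by fun_prop) fun x hx => ?_))
    (fun x hx => (hasDerivAt_substWeight (by linarith [hx.2])).ofReal_comp.mul (hd x hx))
    (fun x hx => ?_)
    (ContinuousOn.intervalIntegrable_of_Icc (by norm_num) ?_)
    (IntervalIntegrable.mul_continuousOn ?_ ?_)
    (fun x hx => ?_) ?_
  · have hint : ∫ x in (0 : ℝ)..(1 / 2), x ^ (μ - 1) * (((4 + 2 * μ) / 3 * S + W) * l⁻¹)
        = 2 ^ (-μ) / μ * (((4 + 2 * μ) / 3 * S + W) * l⁻¹) := by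
      rw [intervalIntegral.integral_mul_const, integral_rpow (by left; linarith),
        sub_add_cancel, Real.zero_rpow hμ.ne', sub_zero, one_div,
        Real.inv_rpow (by norm_num), ← Real.rpow_neg (by norm_num)]
    rw [hint] at key
    have hle : 2 ^ (-μ) / μ * (((4 + 2 * μ) / 3 * S + W) * l⁻¹)
        ≤ (2 ^ (2 - μ) / μ * (2 - μ) * S + 2 ^ (1 - μ) / μ * W) * l⁻¹ := by
      have p1 : (2 : ℝ) ^ (2 - μ) = 4 * 2 ^ (-μ) := by
        rw [sub_eq_add_neg, Real.rpow_add (by norm_num)]; norm_num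
      have p2 : (2 : ℝ) ^ (1 - μ) = 2 * 2 ^ (-μ) := by
        rw [sub_eq_add_neg, Real.rpow_add (by norm_num)]; norm_num
      rw [p1, p2]
      have h1 : (4 + 2 * μ) / 3 * S ≤ 4 * (2 - μ) * S := by
        gcongr
        linarith
      have h2 : (4 + 2 * μ) / 3 * S + W ≤ 4 * (2 - μ) * S + 2 * W := by linarith
      calc 2 ^ (-μ) / μ * (((4 + 2 * μ) / 3 * S + W) * l⁻¹)
          ≤ 2 ^ (-μ) / μ * ((4 * (2 - μ) * S + 2 * W) * l⁻¹) := by gcongr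
        _ = _ := by ring
    refine le_trans (le_of_eq ?_) (key.trans hle)
    congr 1
    congr 1
    · refine intervalIntegral.integral_congr fun x hx => ?_
      rw [uIcc_of_le (by norm_num)] at hx
      have hx1 : 1 - x ≠ 0 := by linarith [hx.2]
      have hm : substWeight μ x * ((2 - x) ^ (μ - 1) * (2 * (1 - x))) = 1 := by
        rw [← mul_assoc, substWeight_mul (by linarith [hx.2])]
        field_simp
      have hm' : ((substWeight μ x : ℝ) : ℂ) * (((2 - x) ^ (μ - 1) * (2 * (1 - x)) : ℝ) : ℂ) = 1 := by
        exact_mod_cast hm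
      simp only [scaledIntegrand]
      linear_combination (-((x ^ (μ - 1) : ℝ) : ℂ) * v x * exp (-(I * l * ((x - 1) ^ 2 : ℝ)))) * hm'
    · have e1 : (1 / 2 : ℝ) * (2 - 1 / 2) = 3 / 4 := by norm_num
      have e2 : (0 : ℝ) * (2 - 0) = 0 := by norm_num
      simp only [e1, e2]
      ring
  · exact mul_nonneg hx.1 (by linarith [hx.2])
  · have hx0 : 0 < x * (2 - x) := mul_pos hx.1 (by linarith [hx.2])
    have h1 : HasDerivAt (fun x : ℝ => x * (2 - x)) (2 * (1 - x)) x := by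
      refine ((hasDerivAt_id x).mul ((hasDerivAt_id x).const_sub 2)).congr_deriv ?_
      simp only [id]
      ring
    have h2 := HasDerivAt.scomp (h := fun x : ℝ => x * (2 - x)) x
      (hasDerivAt_powPrimitive hμ1.le hl hx0) h1
    refine (h2.const_mul _).congr_deriv ?_
    rw [hrpow x ⟨hx.1.le, hx.2.le⟩]
    have h3 : exp (-(I * l * ((x - 1) ^ 2 : ℝ)))
        = exp (-(I * l)) * exp (I * l * (x * (2 - x) : ℝ)) := by
      rw [← exp_add]
      congr 1
      push_cast
      ring
    rw [h3]
    simp only [real_smul]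
    push_cast
    ring
  · exact (ContinuousOn.mul (continuous_ofReal.comp_continuousOn continuousOn_substWeightDeriv)
      hv).add (ContinuousOn.mul (continuous_ofReal.comp_continuousOn continuousOn_substWeight) hv')
  · exact intervalIntegrable_rpow_ofReal (by linarith) _ _
  · rw [uIcc_of_le (by norm_num)]
    refine ContinuousOn.mul (continuous_ofReal.comp_continuousOn ?_) (by fun_prop)
    refine ContinuousOn.mul (ContinuousOn.rpow_const (by fun_prop) fun x hx => ?_) (by fun_prop)
    left
    linarith [hx.2]
  · have hx0 : 0 < x * (2 - x) := mul_pos hx.1 (by linarith [hx.2])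
    have hx1 : 0 < 1 - x := by linarith [hx.2]
    have hx2 : 0 < 2 - x := by linarith [hx.2]
    have hm0 : 0 ≤ substWeight μ x := by unfold substWeight; positivity
    have hq0 : 0 ≤ (1 + μ * (1 - x)) / ((1 - x) * (2 - x)) := by positivity
    have hq : (1 + μ * (1 - x)) / ((1 - x) * (2 - x)) ≤ (4 + 2 * μ) / 3 := by
      rw [div_le_div_iff₀ (by positivity) (by norm_num)]
      nlinarith [hx.1, hx.2, mul_pos hμ hx1, mul_pos (mul_pos hμ hx1) (sub_pos.2 hx.2)]
    have hA : ‖((substWeightDeriv μ x : ℝ) : ℂ) * v x + ((substWeight μ x : ℝ) : ℂ) * v' x‖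
        ≤ substWeight μ x * ((4 + 2 * μ) / 3 * S + W) := by
      refine (norm_add_le _ _).trans ?_
      rw [norm_mul, norm_mul, norm_real, norm_real, Real.norm_of_nonneg hm0, substWeightDeriv,
        Real.norm_of_nonneg (mul_nonneg hm0 hq0), mul_assoc, ← mul_add]
      gcongr
      · exact hS x hx
      · exact hW x hx
    have hF : ‖exp (-(I * l)) * powPrimitive μ l (x * (2 - x))‖
        ≤ x ^ (μ - 1) * (2 - x) ^ (μ - 1) * l⁻¹ := by
      have h1 : ‖exp (-(I * l))‖ = 1 := by
        have := norm_exp_I_mul_ofReal_mul l (-1)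
        simpa using this
      rw [norm_mul, h1, one_mul, norm_powPrimitive, ← hrpow x ⟨hx.1.le, hx.2.le⟩, ← div_eq_mul_inv]
      exact norm_rayLaplace_le (by linarith) hl hx0
    have hp : 0 ≤ x ^ (μ - 1) := Real.rpow_nonneg hx.1.le _
    calc _ ≤ (substWeight μ x * ((4 + 2 * μ) / 3 * S + W))
          * (x ^ (μ - 1) * (2 - x) ^ (μ - 1) * l⁻¹) :=
        mul_le_mul hA hF (norm_nonneg _) (by positivity)
      _ = (substWeight μ x * (2 - x) ^ (μ - 1))
          * (x ^ (μ - 1) * (((4 + 2 * μ) / 3 * S + W) * l⁻¹)) := by ring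
      _ ≤ 1 * (x ^ (μ - 1) * (((4 + 2 * μ) / 3 * S + W) * l⁻¹)) := by
        gcongr
        -- The product is `1 / (2 * (1 - x))`, at most `1` precisely because `x ≤ 1/2`.
        rw [substWeight_mul (by linarith), div_le_one (by positivity)]
        linarith [hx.2]
      _ = _ := one_mul _
  · exact (intervalIntegral.intervalIntegrable_rpow' (by linarith)).mul_const _

/-- The boundary terms at the cut cancel to leading order. -/
theorem norm_cut_terms_le (hμ1 : μ ≤ 1) (hl : 0 < l) (z : ℂ) (hz : ‖z‖ ≤ S) :
    ‖exp (-(I * l)) * (((substWeight μ (1 / 2) : ℝ) : ℂ) * z * powPrimitive μ l (3 / 4))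
        + ((2 ^ (1 - μ) : ℝ) : ℂ) * z * fresnelPrimitive l (1 / 2)‖
      ≤ (1 - μ) * (2 ^ (3 - μ) / 3) * S * l ^ (-2 : ℝ)
        + Real.sqrt Real.pi * 2 ^ (2 - μ) * S * l ^ (-(3 / 2) : ℝ) := by
  have h1 := norm_powPrimitive_sub_le (s := 3 / 4) hμ1 hl (by norm_num)
  have h2 := norm_fresnelPrimitive_half_sub_le hl
  set R1 := powPrimitive μ l (3 / 4) - -I * exp (I * l * ((3 / 4 : ℝ) : ℂ))
    * (((3 / 4) ^ (μ - 1) / l : ℝ) : ℂ) with hR1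
  set R2 := fresnelPrimitive l (1 / 2) - I * exp (-(I * l * (1 / 4))) / l with hR2
  have hw : substWeight μ (1 / 2) = (3 / 2) ^ (1 - μ) := by
    unfold substWeight
    norm_num
  -- `3/4` is the value of `x(2 - x)` at the cut. This identity and `hexp` say that the `1/l` terms
  -- from the two sides have the same modulus and phase; their signs are opposite.
  have hq : (3 / 2 : ℝ) ^ (1 - μ) * (3 / 4) ^ (μ - 1) = 2 ^ (1 - μ) := by
    rw [← neg_sub 1 μ, Real.rpow_neg (by norm_num), ← Real.inv_rpow (by norm_num),
      ← Real.mul_rpow (by norm_num) (by norm_num)]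
    norm_num
  have hq2 : (3 / 2 : ℝ) ^ (1 - μ) * (3 / 4) ^ (μ - 1 - 1) = 2 ^ (3 - μ) / 3 := by
    rw [Real.rpow_sub_one (by norm_num) (μ - 1), mul_div_assoc', hq]
    have : (2 : ℝ) ^ (3 - μ) = 4 * 2 ^ (1 - μ) := by
      rw [show 3 - μ = 2 + (1 - μ) by ring, Real.rpow_add (by norm_num)]
      norm_num
    rw [this]
    ring
  have hexp : exp (-(I * l)) * exp (I * l * ((3 / 4 : ℝ) : ℂ)) = exp (-(I * l * (1 / 4))) := by
    rw [← exp_add]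
    congr 1
    push_cast
    ring
  have hq' : (((3 / 2) ^ (1 - μ) : ℝ) : ℂ) * (((3 / 4) ^ (μ - 1) : ℝ) : ℂ)
      = ((2 ^ (1 - μ) : ℝ) : ℂ) := by exact_mod_cast hq
  have heq : exp (-(I * l)) * (((substWeight μ (1 / 2) : ℝ) : ℂ) * z * powPrimitive μ l (3 / 4))
        + ((2 ^ (1 - μ) : ℝ) : ℂ) * z * fresnelPrimitive l (1 / 2)
      = exp (-(I * l)) * (((3 / 2) ^ (1 - μ) : ℝ) : ℂ) * z * R1
        + ((2 ^ (1 - μ) : ℝ) : ℂ) * z * R2 := by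
    rw [hR1, hR2, hw, ← hexp, ← hq']
    rw [ofReal_div ((3 / 4) ^ (μ - 1)) l]
    ring
  have hn : ‖exp (-(I * l))‖ = 1 := by
    have := norm_exp_I_mul_ofReal_mul l (-1)
    simpa using this
  have hS0 : 0 ≤ S := (norm_nonneg _).trans hz
  rw [heq]
  refine (norm_add_le _ _).trans (add_le_add ?_ ?_)
  · rw [norm_mul, norm_mul, norm_mul, hn, norm_real, Real.norm_of_nonneg (by positivity), one_mul]
    calc (3 / 2 : ℝ) ^ (1 - μ) * ‖z‖ * ‖R1‖
        ≤ (3 / 2 : ℝ) ^ (1 - μ) * S * ((1 - μ) * (3 / 4) ^ (μ - 1 - 1) / l ^ 2) := by gcongr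
      _ = (1 - μ) * ((3 / 2 : ℝ) ^ (1 - μ) * (3 / 4) ^ (μ - 1 - 1)) * S * (l ^ 2)⁻¹ := by ring
      _ = _ := by
        rw [hq2, Real.rpow_neg hl.le]
        norm_cast
  · rw [norm_mul, norm_mul, norm_real, Real.norm_of_nonneg (by positivity)]
    -- A factor `2` is given away to reach the stated constant `R₆`.
    have : (2 : ℝ) ^ (1 - μ) ≤ 2 ^ (2 - μ) :=
      Real.rpow_le_rpow_of_exponent_le (by norm_num) (by linarith)
    calc (2 : ℝ) ^ (1 - μ) * ‖z‖ * ‖R2‖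
        ≤ 2 ^ (2 - μ) * S * (Real.sqrt Real.pi * l ^ (-(3 / 2) : ℝ)) := by gcongr
      _ = _ := by ring

/-! ### Assembly of the rescaled expansion. -/

theorem intervalIntegrable_scaledIntegrand (hμ : 0 < μ) (hX : 0 ≤ X)
    (hv : ContinuousOn v (Icc 0 X)) :
    IntervalIntegrable (scaledIntegrand μ l v) volume 0 X := by
  have h : IntervalIntegrable (fun x : ℝ => ((x ^ (μ - 1) : ℝ) : ℂ)
      * (v x * exp (-(I * l * ((x - 1) ^ 2 : ℝ))))) volume 0 X := by
    refine IntervalIntegrable.mul_continuousOn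
      (intervalIntegrable_rpow_ofReal (by linarith) _ _) ?_
    rw [uIcc_of_le hX]
    exact hv.mul (by fun_prop)
  refine h.congr fun x _ => ?_
  simp only [scaledIntegrand]
  ring

/-- The expansion of the rescaled integral, uniformly in the frequency `l > 0`. -/
theorem norm_integral_scaledIntegrand_sub_le {γ : ℝ} (hμ : 0 < μ) (hμ1 : μ < 1) (hl : 0 < l)
    (hγ : 0 ≤ γ) (hγ1 : γ < 1) (hX : 1 ≤ X) (hv : ContinuousOn v (Icc 0 X))
    (hv' : ContinuousOn v' (Icc 0 X)) (hd : ∀ x ∈ Ioo 0 X, HasDerivAt v (v' x) x)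
    (hS : ∀ x ∈ Icc 0 X, ‖v x‖ ≤ S) (hW : ∀ x ∈ Ioo 0 X, ‖v' x‖ ≤ W) (hvX : v X = 0) :
    ‖(∫ x in (0 : ℝ)..X, scaledIntegrand μ l v x)
      - (v 1 * ((Real.sqrt Real.pi : ℂ) * exp (-(I * (Real.pi / 4))) * ((l ^ (-(1 / 2) : ℝ) : ℝ) : ℂ))
        + v 0 * (((Real.Gamma μ / 2 ^ μ : ℝ) : ℂ) * exp (I * (Real.pi * μ / 2)) * exp (-(I * l))
          * ((l ^ (-μ) : ℝ) : ℂ)))‖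
      ≤ (2 ^ (2 - μ) / μ * (2 - μ) * S + 2 ^ (1 - μ) / μ * W) * l⁻¹
        + ((1 - μ) * (2 ^ (3 - μ) / 3) * S * l ^ (-2 : ℝ)
          + Real.sqrt Real.pi * 2 ^ (2 - μ) * S * l ^ (-(3 / 2) : ℝ))
        + ((1 - μ) * 2 ^ (2 - μ) * S + 2 ^ (1 - μ) * W)
          * (constL γ * l ^ (-((1 + γ) / 2)) / (1 - γ))
        + ((1 - μ) * S + W) * (constL γ * l ^ (-((1 + γ) / 2)) / (1 - γ)) * X ^ (1 - γ) := by
  have hS0 : 0 ≤ S := (norm_nonneg _).trans (hS 0 ⟨le_rfl, by linarith⟩)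
  have hW0 : 0 ≤ W := (norm_nonneg _).trans (hW (1 / 2) ⟨by norm_num, by linarith⟩)
  have i : ∀ a b, 0 ≤ a → a ≤ b → b ≤ X →
      IntervalIntegrable (scaledIntegrand μ l v) volume a b := fun a b ha hab hb =>
    (intervalIntegrable_scaledIntegrand hμ (by linarith) hv).mono_set
      (by rw [uIcc_of_le hab, uIcc_of_le (by linarith)]; exact Icc_subset_Icc ha hb)
  have sI : ∀ a b : ℝ, 0 ≤ a → b ≤ X → Icc a b ⊆ Icc 0 X := fun a b ha hb => Icc_subset_Icc ha hb
  have sO : ∀ a b : ℝ, 0 ≤ a → b ≤ X → Ioo a b ⊆ Ioo 0 X := fun a b ha hb => Ioo_subset_Ioo ha hb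
  have b1 := norm_integral_singular_sub_le (S := S) (W := W) hμ hμ1 hl
    (hv.mono (sI _ _ le_rfl (by linarith)))
    (hv'.mono (sI _ _ le_rfl (by linarith)))
    (fun x hx => hd x (sO _ _ le_rfl (by linarith) hx))
    (fun x hx => hS x (sI _ _ le_rfl (by linarith) (Ioo_subset_Icc_self hx)))
    (fun x hx => hW x (sO _ _ le_rfl (by linarith) hx)) hS0 hW0
  have b2 := norm_integral_left_of_stationary_sub_le (S := S) (W := W) hμ1.le hl hγ hγ1
    (hv.mono (sI _ _ (by norm_num) hX))
    (hv'.mono (sI _ _ (by norm_num) hX))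
    (fun x hx => hd x (sO _ _ (by norm_num) hX hx))
    (fun x hx => hS x (sI _ _ (by norm_num) hX (Ioo_subset_Icc_self hx)))
    (fun x hx => hW x (sO _ _ (by norm_num) hX hx)) hS0 hW0
  have b3 := norm_integral_right_of_stationary_sub_le (S := S) (W := W) hμ1.le hl hγ hγ1 hX
    (hv.mono (sI _ _ (by norm_num) le_rfl))
    (hv'.mono (sI _ _ (by norm_num) le_rfl))
    (fun x hx => hd x (sO _ _ (by norm_num) le_rfl hx))
    (fun x hx => hS x (sI _ _ (by norm_num) le_rfl (Ioo_subset_Icc_self hx)))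
    (fun x hx => hW x (sO _ _ (by norm_num) le_rfl hx)) hS0 hW0 hvX
  have b4 := norm_cut_terms_le hμ1.le hl (v (1 / 2)) (hS (1 / 2) ⟨by norm_num, by linarith⟩)
  have split : ∫ x in (0 : ℝ)..X, scaledIntegrand μ l v x
      = (∫ x in (0 : ℝ)..(1 / 2), scaledIntegrand μ l v x)
        + (∫ x in (1 / 2 : ℝ)..1, scaledIntegrand μ l v x)
        + ∫ x in (1 : ℝ)..X, scaledIntegrand μ l v x := by
    rw [intervalIntegral.integral_add_adjacent_intervals (i _ _ le_rfl (by norm_num) (by linarith))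
      (i _ _ (by norm_num) (by norm_num) hX), intervalIntegral.integral_add_adjacent_intervals
      (i _ _ le_rfl (by norm_num) hX) (i _ _ (by norm_num) hX le_rfl)]
  have hw0 : substWeight μ 0 = (2 ^ μ)⁻¹ := by
    have h : (2 : ℝ) ^ (1 - μ) = 2 * (2 ^ μ)⁻¹ := by
      rw [Real.rpow_sub (by norm_num), Real.rpow_one, div_eq_mul_inv]
    rw [substWeight, sub_zero, h]
    ring
  -- Each side of the stationary point contributes `-v 1 * fresnelPrimitive l 0`, whence the factor
  -- `2` in the main term there.
  have e0 := fresnelPrimitive_zero hl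
  have e1 := powPrimitive_zero hμ hl
  rw [split, ← e0]
  have hK : v 0 * (((Real.Gamma μ / 2 ^ μ : ℝ) : ℂ) * exp (I * (Real.pi * μ / 2)) * exp (-(I * l))
      * ((l ^ (-μ) : ℝ) : ℂ))
      = -(exp (-(I * l)) * (((substWeight μ 0 : ℝ) : ℂ) * v 0 * powPrimitive μ l 0)) := by
    rw [e1, hw0]
    push_cast
    ring
  rw [hK]
  refine le_trans (le_of_eq ?_) ((norm_add_le _ _).trans (add_le_add ((norm_add_le _ _).trans
    (add_le_add ((norm_add_le _ _).trans (add_le_add b1 b4)) b2)) b3))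
  congr 1
  ring

end Amplitude

/-! ### Sup norms, signs of the constants, comparison of exponents. -/

/-- The `L^∞` norm controls the values of a continuous representative. -/
theorem norm_le_linftyNorm {p₁ p₂ : ℝ} (hp : p₁ < p₂) {f g : ℝ → ℂ}
    (hg : ContinuousOn g (Icc p₁ p₂)) (hfg : EqOn f g (Ioo p₁ p₂)) :
    ∀ p ∈ Icc p₁ p₂, ‖g p‖ ≤ linftyNorm p₁ p₂ f := by
  obtain ⟨C, hC⟩ := isCompact_Icc.exists_bound_of_continuousOn hg
  have hfin : eLpNormEssSup f (volume.restrict (Ioo p₁ p₂)) < ⊤ := by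
    refine eLpNormEssSup_lt_top_of_ae_bound (C := C)
      ((ae_restrict_iff' measurableSet_Ioo).2 (ae_of_all _ fun p hp => ?_))
    rw [hfg hp]
    exact hC p (Ioo_subset_Icc_self hp)
  have hae : ∀ᵐ p ∂volume.restrict (Ioo p₁ p₂), ‖g p‖ ≤ linftyNorm p₁ p₂ f := by
    filter_upwards [ae_le_eLpNormEssSup (f := f) (μ := volume.restrict (Ioo p₁ p₂)),
      ae_restrict_mem measurableSet_Ioo] with p h1 h2
    rw [← hfg h2, linftyNorm, eLpNorm_exponent_top, ← toReal_enorm]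
    exact ENNReal.toReal_mono hfin.ne h1
  -- Writing the inequality as an equality of continuous functions lets it pass from almost every
  -- point to every point, endpoints included.
  have hEq : (fun p => max ‖g p‖ (linftyNorm p₁ p₂ f))
      =ᵐ[volume.restrict (Icc p₁ p₂)] fun _ => linftyNorm p₁ p₂ f := by
    rw [← restrict_Ioo_eq_restrict_Icc]
    filter_upwards [hae] with p h
    exact max_eq_right h
  intro p hpI
  have := Measure.eqOn_Icc_of_ae_eq volume hp.ne hEq
    (ContinuousOn.sup hg.norm continuousOn_const) continuousOn_const hpI
  exact max_eq_right_iff.1 this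

theorem linftyNorm_nonneg (p₁ p₂ : ℝ) (f : ℝ → ℂ) : 0 ≤ linftyNorm p₁ p₂ f :=
  ENNReal.toReal_nonneg

theorem constL_nonneg (γ : ℝ) : 0 ≤ constL γ := by
  have := one_le_rootK
  unfold constL
  positivity

theorem remConst_nonneg {p₁ p₂ μ δ : ℝ} (hp : p₁ < p₂) (hμ : 0 < μ) (hμ1 : μ < 1) (hδ : δ < 1)
    (u : ℝ → ℂ) (k : Fin 8) : 0 ≤ remConst p₁ p₂ μ δ u k := by
  have hS := linftyNorm_nonneg p₁ p₂ u
  have hW : 0 ≤ w1inftyNorm p₁ p₂ u := hS.trans (le_max_left _ _)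
  have hL := constL_nonneg (2 * δ - 1)
  have h1 : 0 < 1 - (2 * δ - 1) := by linarith
  have h2 : 0 < 1 - μ := by linarith
  have h3 : 0 < 2 - μ := by linarith
  have h4 : 0 < p₂ - p₁ := by linarith
  have h5 := div_nonneg hL h1.le
  fin_cases k <;> simp only [remConst] <;> simp <;> positivity

/-- The seventh term is the one that is exactly equivalent to `1/2 + ε < δ`. The others follow from
`0 < ε < 1/2` and `δ > 1/2`. -/
theorem remExponent_lt {μ δ ε : ℝ} (hε0 : 0 < ε) (hε : ε < 1 / 2)
    (hδ : 1 / 2 < δ) (hδε : 1 / 2 + ε < δ) (k : Fin 8) :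
    -remBeta δ k + ε * remAlpha μ δ k < -(1 / 2) + ε * (1 - μ) := by
  fin_cases k <;> simp [remBeta, remAlpha] <;> nlinarith

/-! ### The amplitude and the rescaling. -/

namespace IsRegularPart

variable {p₁ p₂ μ : ℝ} {U u : ℝ → ℂ}

theorem apply_eq (hU : IsRegularPart p₁ p₂ μ 1 1 U u) {p : ℝ} (hp : p ∈ Ioo p₁ p₂) :
    U p = (((p - p₁) ^ (μ - 1) : ℝ) : ℂ) * u p := by
  rw [hU.eq_mul p hp]
  simp

theorem continuousOn (hU : IsRegularPart p₁ p₂ μ 1 1 U u) : ContinuousOn u (Icc p₁ p₂) :=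
  hU.contDiffOn.continuousOn

theorem continuousOn_derivWithin (hU : IsRegularPart p₁ p₂ μ 1 1 U u) (hp : p₁ < p₂) :
    ContinuousOn (derivWithin u (Icc p₁ p₂)) (Icc p₁ p₂) :=
  hU.contDiffOn.continuousOn_derivWithin (uniqueDiffOn_Icc hp) (by norm_num)

theorem hasDerivAt (hU : IsRegularPart p₁ p₂ μ 1 1 U u) {p : ℝ} (hp : p ∈ Ioo p₁ p₂) :
    HasDerivAt u (derivWithin u (Icc p₁ p₂) p) p :=
  ((hU.contDiffOn.differentiableOn (by norm_num)) p
    (Ioo_subset_Icc_self hp)).hasDerivWithinAt.hasDerivAt (Icc_mem_nhds hp.1 hp.2)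

theorem norm_le (hU : IsRegularPart p₁ p₂ μ 1 1 U u) (hp : p₁ < p₂) {p : ℝ}
    (hpI : p ∈ Icc p₁ p₂) : ‖u p‖ ≤ linftyNorm p₁ p₂ u :=
  norm_le_linftyNorm hp hU.continuousOn (fun _ _ => rfl) p hpI

/-- `derivWithin` is the continuous representative on the closed interval; it agrees with `deriv`,
which defines the norm, on the open one. -/
theorem norm_derivWithin_le (hU : IsRegularPart p₁ p₂ μ 1 1 U u) (hp : p₁ < p₂) {p : ℝ}
    (hpI : p ∈ Icc p₁ p₂) : ‖derivWithin u (Icc p₁ p₂) p‖ ≤ w1inftyNorm p₁ p₂ u :=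
  (norm_le_linftyNorm hp (hU.continuousOn_derivWithin hp)
    (fun _ hq => (derivWithin_of_mem_nhds (Icc_mem_nhds hq.1 hq.2)).symm) p hpI).trans
    (le_max_right _ _)

/-- The singular factor has a finite nonzero limit at `p₂`, so the vanishing of `U` passes to `u`.
This removes the boundary term at the right endpoint. -/
theorem apply_right_eq_zero (hU : IsRegularPart p₁ p₂ μ 1 1 U u) (hp : p₁ < p₂)
    (hU₂ : Tendsto U (𝓝[<] p₂) (𝓝 0)) : u p₂ = 0 := by
  have hev : ∀ᶠ p in 𝓝[<] p₂, p ∈ Ioo p₁ p₂ := Ioo_mem_nhdsLT hp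
  have h1 : Tendsto u (𝓝[<] p₂) (𝓝 (u p₂)) := by
    rw [← nhdsWithin_Ioo_eq_nhdsLT hp]
    exact ((hU.continuousOn p₂ (right_mem_Icc.2 hp.le)).mono Ioo_subset_Icc_self)
  have h2 : Tendsto (fun p : ℝ => (((p - p₁) ^ (1 - μ) : ℝ) : ℂ)) (𝓝[<] p₂)
      (𝓝 (((p₂ - p₁) ^ (1 - μ) : ℝ) : ℂ)) := by
    have : ContinuousAt (fun p : ℝ => (((p - p₁) ^ (1 - μ) : ℝ) : ℂ)) p₂ :=
      continuous_ofReal.continuousAt.comp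
        (ContinuousAt.rpow_const (by fun_prop) (Or.inl (by linarith)))
    exact this.tendsto.mono_left nhdsWithin_le_nhds
  have h3 := h2.mul hU₂
  rw [mul_zero] at h3
  refine tendsto_nhds_unique (h1.congr' ?_) h3
  filter_upwards [hev] with p hpp
  rw [hU.apply_eq hpp, ← mul_assoc, ← ofReal_mul, ← Real.rpow_add (by linarith [hpp.1])]
  simp

theorem intervalIntegrable_integrand (hU : IsRegularPart p₁ p₂ μ 1 1 U u) (hp : p₁ < p₂)
    (hμ : 0 < μ) (c ω p₀ : ℝ) :
    IntervalIntegrable (integrand U (phase p₀ c) ω) volume p₁ p₂ := by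
  have h1 := (intervalIntegrable_rpow_ofReal (r := μ - 1) (by linarith) 0 (p₂ - p₁)).comp_sub_right p₁
  rw [zero_add, sub_add_cancel] at h1
  have h2 : IntervalIntegrable (fun p => (((p - p₁) ^ (μ - 1) : ℝ) : ℂ)
      * (u p * exp (I * ω * phase p₀ c p))) volume p₁ p₂ := by
    refine h1.mul_continuousOn ?_
    rw [uIcc_of_le hp.le]
    refine hU.continuousOn.mul (Continuous.continuousOn ?_)
    unfold phase
    fun_prop
  refine h2.congr_ae ?_
  rw [uIoc_of_le hp.le]
  filter_upwards [ae_restrict_mem measurableSet_Ioc, ae_restrict_of_ae (Measure.ae_ne volume p₂)]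
    with p h3 h4
  rw [integrand, hU.apply_eq ⟨h3.1, lt_of_le_of_ne h3.2 h4⟩]
  ring

/-- Rescaling the integral so that the distance from `p₁` to `p₀` becomes `1`. -/
theorem integral_integrand_eq (hU : IsRegularPart p₁ p₂ μ 1 1 U u) (hp : p₁ < p₂) (c ω : ℝ) {d : ℝ}
    (hd : 0 < d) :
    ∫ p in p₁..p₂, integrand U (phase (p₁ + d) c) ω p
      = ((d ^ μ : ℝ) : ℂ) * exp (I * ω * c)
        * ∫ x in (0 : ℝ)..((p₂ - p₁) / d),
          scaledIntegrand μ (ω * d ^ 2) (fun x => u (d * x + p₁)) x := by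
  have h := intervalIntegral.integral_comp_mul_add (a := 0) (b := (p₂ - p₁) / d)
    (integrand U (phase (p₁ + d) c) ω) hd.ne' p₁
  have e1 : d * 0 + p₁ = p₁ := by ring
  have e2 : d * ((p₂ - p₁) / d) + p₁ = p₂ := by field_simp; ring
  have hX : 0 < (p₂ - p₁) / d := div_pos (by linarith) hd
  rw [e1, e2, real_smul] at h
  have hd' : (d : ℂ) ≠ 0 := by exact_mod_cast hd.ne'
  have h2 : ∫ p in p₁..p₂, integrand U (phase (p₁ + d) c) ω p
      = d * ∫ x in (0 : ℝ)..((p₂ - p₁) / d), integrand U (phase (p₁ + d) c) ω (d * x + p₁) := by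
    rw [h]
    push_cast
    field_simp
  rw [h2, ← intervalIntegral.integral_const_mul, ← intervalIntegral.integral_const_mul]
  refine intervalIntegral.integral_congr_ae ?_
  rw [uIoc_of_le hX.le]
  filter_upwards [Measure.ae_ne volume ((p₂ - p₁) / d)] with x hx hxI
  have hx2 : x < (p₂ - p₁) / d := lt_of_le_of_ne hxI.2 hx
  have hx0 : 0 < x := hxI.1
  have hm : d * x + p₁ ∈ Ioo p₁ p₂ := by
    constructor
    · nlinarith [mul_pos hd hx0]
    · rw [lt_div_iff₀ hd] at hx2
      linarith
  rw [integrand, hU.apply_eq hm, scaledIntegrand, add_sub_cancel_right,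
    Real.mul_rpow hd.le hx0.le, Real.rpow_sub_one hd.ne']
  have h3 : exp (I * ω * phase (p₁ + d) c (d * x + p₁))
      = exp (I * ω * c) * exp (-(I * (ω * d ^ 2 : ℝ) * ((x - 1) ^ 2 : ℝ))) := by
    rw [← exp_add, phase]
    congr 1
    push_cast
    ring
  rw [h3]
  push_cast
  field_simp

end IsRegularPart

/-! ### Return to the frequency `ω`. -/

/-- The two-term expansion with the eight common error terms, valid for every `μ ∈ (0, 1)`. -/
theorem norm_integral_sub_two_terms_le {p₁ p₂ : ℝ} (hp : p₁ < p₂) {μ : ℝ} (hμ : 0 < μ)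
    (hμ1 : μ < 1) {U u : ℝ → ℂ} (hU : IsRegularPart p₁ p₂ μ 1 1 U u)
    (hU₂ : Tendsto U (𝓝[<] p₂) (𝓝 0)) {ε δ : ℝ} (hδ : 1 / 2 < δ) (hδ1 : δ < 1)
    {c ω : ℝ} (hω : 0 < ω) (hd : ω ^ (-ε) < p₂ - p₁) :
    ‖(∫ p in p₁..p₂, integrand U (phase (p₁ + ω ^ (-ε)) c) ω p)
        - (coeffH u (p₁ + ω ^ (-ε)) c ω * ((ω ^ (-(1 / 2) + ε * (1 - μ)) : ℝ) : ℂ)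
          + coeffK μ (phase (p₁ + ω ^ (-ε)) c) u p₁ ω * ((ω ^ (-μ + ε * μ) : ℝ) : ℂ))‖
      ≤ ∑ k, remConst p₁ p₂ μ δ u k * ω ^ (-remBeta δ k + ε * remAlpha μ δ k) := by
  set d := ω ^ (-ε) with hdd
  have hd0 : 0 < d := Real.rpow_pos_of_pos hω _
  set X := (p₂ - p₁) / d with hXd
  have hX1 : 1 ≤ X := by rw [hXd, one_le_div hd0]; exact hd.le
  set l := ω * d ^ 2 with hl
  have hl0 : 0 < l := by positivity
  set S := linftyNorm p₁ p₂ u with hS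
  set W := w1inftyNorm p₁ p₂ u with hW
  have hS0 : 0 ≤ S := linftyNorm_nonneg _ _ _
  have hSW : S ≤ W := le_max_left _ _
  have hmaps : MapsTo (fun x => d * x + p₁) (Icc 0 X) (Icc p₁ p₂) := fun x hx => by
    have h2 := hx.2
    rw [hXd, le_div_iff₀ hd0] at h2
    exact ⟨by nlinarith [mul_nonneg hd0.le hx.1], by linarith⟩
  have hmaps' : MapsTo (fun x => d * x + p₁) (Ioo 0 X) (Ioo p₁ p₂) := fun x hx => by
    have h2 := hx.2
    rw [hXd, lt_div_iff₀ hd0] at h2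
    exact ⟨by nlinarith [mul_pos hd0 hx.1], by linarith⟩
  -- By the chain rule the derivative bound becomes `d * W`; this extra `d` lowers the blow-up
  -- exponents of the second, fifth and eighth terms by one.
  have core := norm_integral_scaledIntegrand_sub_le (μ := μ) (l := l) (X := X) (S := S) (W := d * W)
    (γ := 2 * δ - 1) (v := fun x => u (d * x + p₁))
    (v' := fun x => (d : ℂ) * derivWithin u (Icc p₁ p₂) (d * x + p₁)) hμ hμ1 hl0
    (by linarith) (by linarith) hX1
    (hU.continuousOn.comp (by fun_prop) hmaps)
    (continuousOn_const.mul ((hU.continuousOn_derivWithin hp).comp (by fun_prop) hmaps))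
    (fun x hx => by
      have h1 : HasDerivAt (fun x : ℝ => d * x + p₁) d x := by
        simpa using ((hasDerivAt_id x).const_mul d).add_const p₁
      exact (HasDerivAt.scomp (h := fun x : ℝ => d * x + p₁) x
        (hU.hasDerivAt (hmaps' hx)) h1).congr_deriv real_smul)
    (fun x hx => hU.norm_le hp (hmaps hx))
    (fun x hx => by
      rw [norm_mul, norm_real, Real.norm_of_nonneg hd0.le]
      exact mul_le_mul_of_nonneg_left
        (hU.norm_derivWithin_le hp (Ioo_subset_Icc_self (hmaps' hx))) hd0.le)
    (by
      have : d * X + p₁ = p₂ := by rw [hXd]; field_simp; ring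
      simp only [this]
      exact hU.apply_right_eq_zero hp hU₂)
  have hlp : ∀ a : ℝ, l ^ a = ω ^ (a - 2 * ε * a) := fun a => by
    rw [hl, Real.mul_rpow hω.le (by positivity), hdd, ← Real.rpow_natCast, ← Real.rpow_mul hω.le,
      ← Real.rpow_mul hω.le, ← Real.rpow_add hω]
    push_cast
    ring_nf
  have hdp : ∀ a : ℝ, d ^ a = ω ^ (-(ε * a)) := fun a => by
    rw [hdd, ← Real.rpow_mul hω.le]
    ring_nf
  have hexp : ‖exp (I * ω * c)‖ = 1 := norm_exp_I_mul_ofReal_mul ω c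
  have hmain : (∫ p in p₁..p₂, integrand U (phase (p₁ + d) c) ω p)
        - (coeffH u (p₁ + d) c ω * ((ω ^ (-(1 / 2) + ε * (1 - μ)) : ℝ) : ℂ)
          + coeffK μ (phase (p₁ + d) c) u p₁ ω * ((ω ^ (-μ + ε * μ) : ℝ) : ℂ))
      = ((d ^ μ : ℝ) : ℂ) * exp (I * ω * c)
        * ((∫ x in (0 : ℝ)..X, scaledIntegrand μ l (fun x => u (d * x + p₁)) x)
          - (u (d * 1 + p₁) * ((Real.sqrt Real.pi : ℂ) * exp (-(I * (Real.pi / 4)))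
              * ((l ^ (-(1 / 2) : ℝ) : ℝ) : ℂ))
            + u (d * 0 + p₁) * (((Real.Gamma μ / 2 ^ μ : ℝ) : ℂ) * exp (I * (Real.pi * μ / 2))
              * exp (-(I * l)) * ((l ^ (-μ) : ℝ) : ℂ)))) := by
    rw [hU.integral_integrand_eq hp c ω hd0]
    have e1 : d * 1 + p₁ = p₁ + d := by ring
    have e2 : d * 0 + p₁ = p₁ := by ring
    have e3 : ω ^ (-(1 / 2) + ε * (1 - μ)) = d ^ μ * l ^ (-(1 / 2) : ℝ) := by
      rw [hlp, hdp, ← Real.rpow_add hω]; ring_nf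
    have e4 : ω ^ (-μ + ε * μ) = d ^ μ * l ^ (-μ) := by
      rw [hlp, hdp, ← Real.rpow_add hω]; ring_nf
    have e5 : exp (I * ω * phase (p₁ + d) c p₁) = exp (I * ω * c) * exp (-(I * l)) := by
      rw [← exp_add, phase, hl]
      congr 1
      push_cast
      ring
    rw [e1, e2, e3, e4, coeffH, coeffK, e5]
    push_cast
    ring
  rw [hmain, norm_mul, norm_mul, hexp, mul_one, norm_real, Real.norm_of_nonneg (by positivity)]
  refine (mul_le_mul_of_nonneg_left core (by positivity)).trans ?_
  have hL := constL_nonneg (2 * δ - 1)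
  have hγ : 0 < 1 - (2 * δ - 1) := by linarith
  have hγδ : -((1 + (2 * δ - 1)) / 2) = -δ := by ring
  -- The length `X` grows like `1 / d`; this adds `1 - γ` to the fourth and fifth blow-up exponents,
  -- giving the seventh and eighth.
  have hXp : X ^ (1 - (2 * δ - 1)) = (p₂ - p₁) ^ (1 - (2 * δ - 1)) * ω ^ (ε * (1 - (2 * δ - 1))) := by
    rw [hXd, Real.div_rpow (by linarith) hd0.le, hdp, div_eq_mul_inv, ← Real.rpow_neg hω.le, neg_neg]
  have hμ' : 0 < 1 - μ := by linarith
  have hμ2 : 0 < 2 - μ := by linarith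
  have hp' : 0 < p₂ - p₁ := by linarith
  set Q := constL (2 * δ - 1) / (1 - (2 * δ - 1)) with hQ
  have hQ0 : 0 ≤ Q := div_nonneg hL hγ.le
  have hlinv : l⁻¹ = l ^ (-1 : ℝ) := by rw [Real.rpow_neg_one]
  have hd1 : d = ω ^ (-(ε * 1)) := by rw [hdd, mul_one]
  have f1 : d ^ μ * l ^ (-1 : ℝ) = ω ^ (-1 + ε * (2 - μ)) := by
    rw [hlp, hdp, ← Real.rpow_add hω]; ring_nf
  have f2 : d ^ μ * d * l ^ (-1 : ℝ) = ω ^ (-1 + ε * (1 - μ)) := by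
    rw [hlp, hdp, hd1, ← Real.rpow_add hω, ← Real.rpow_add hω]; ring_nf
  have f3 : d ^ μ * l ^ (-2 : ℝ) = ω ^ (-2 + ε * (4 - μ)) := by
    rw [hlp, hdp, ← Real.rpow_add hω]; ring_nf
  have f4 : d ^ μ * l ^ (-δ) = ω ^ (-δ + ε * (1 + (2 * δ - 1) - μ)) := by
    rw [hlp, hdp, ← Real.rpow_add hω]; ring_nf
  have f5 : d ^ μ * d * l ^ (-δ) = ω ^ (-δ + ε * (2 * δ - 1 - μ)) := by
    rw [hlp, hdp, hd1, ← Real.rpow_add hω, ← Real.rpow_add hω]; ring_nf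
  have f6 : d ^ μ * l ^ (-(3 / 2) : ℝ) = ω ^ (-(3 / 2) + ε * (3 - μ)) := by
    rw [hlp, hdp, ← Real.rpow_add hω]; ring_nf
  have f7 : d ^ μ * l ^ (-δ) * ω ^ (ε * (1 - (2 * δ - 1))) = ω ^ (-δ + ε * (2 - μ)) := by
    rw [hlp, hdp, ← Real.rpow_add hω, ← Real.rpow_add hω]; ring_nf
  have f8 : d ^ μ * d * l ^ (-δ) * ω ^ (ε * (1 - (2 * δ - 1))) = ω ^ (-δ + ε * (1 - μ)) := by
    rw [hlp, hdp, hd1, ← Real.rpow_add hω, ← Real.rpow_add hω, ← Real.rpow_add hω]; ring_nf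
  have h2μ : Real.sqrt Real.pi / 2 ^ (μ - 2) = Real.sqrt Real.pi * 2 ^ (2 - μ) := by
    rw [div_eq_mul_inv, ← Real.rpow_neg (by norm_num), neg_sub]
  have hsum : ∑ k, remConst p₁ p₂ μ δ u k * ω ^ (-remBeta δ k + ε * remAlpha μ δ k)
      = 2 ^ (2 - μ) / μ * (2 - μ) * W * ω ^ (-1 + ε * (2 - μ))
        + 2 ^ (1 - μ) / μ * W * ω ^ (-1 + ε * (1 - μ))
        + (1 - μ) * (2 ^ (3 - μ) / 3) * S * ω ^ (-2 + ε * (4 - μ))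
        + Q * 2 ^ (2 - μ) * (1 - μ) * W * ω ^ (-δ + ε * (1 + (2 * δ - 1) - μ))
        + Q * 2 ^ (1 - μ) * W * ω ^ (-δ + ε * (2 * δ - 1 - μ))
        + Real.sqrt Real.pi / 2 ^ (μ - 2) * S * ω ^ (-(3 / 2) + ε * (3 - μ))
        + Q * (1 - μ) * (p₂ - p₁) ^ (1 - (2 * δ - 1)) * W * ω ^ (-δ + ε * (2 - μ))
        + Q * (p₂ - p₁) ^ (1 - (2 * δ - 1)) * W * ω ^ (-δ + ε * (1 - μ)) := by
    rw [Fin.sum_univ_eight]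
    rfl
  rw [hsum, h2μ, hγδ, hXp, hlinv, ← f1, ← f2, ← f3, ← f4, ← f5, ← f6, ← f7, ← f8]
  set P := (p₂ - p₁) ^ (1 - (2 * δ - 1)) with hP
  have hP0 : 0 ≤ P := by positivity
  set Y := ω ^ (ε * (1 - (2 * δ - 1))) with hY
  have hY0 : 0 ≤ Y := by positivity
  -- In the first, fourth and seventh terms the argument yields `S`; the stated constants have the
  -- larger `W`.
  have g1 : 2 ^ (2 - μ) / μ * (2 - μ) * S * (d ^ μ * l ^ (-1 : ℝ))
      ≤ 2 ^ (2 - μ) / μ * (2 - μ) * W * (d ^ μ * l ^ (-1 : ℝ)) := by gcongr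
  have g4 : Q * 2 ^ (2 - μ) * (1 - μ) * S * (d ^ μ * l ^ (-δ))
      ≤ Q * 2 ^ (2 - μ) * (1 - μ) * W * (d ^ μ * l ^ (-δ)) := by gcongr
  have g7 : Q * (1 - μ) * P * S * (d ^ μ * l ^ (-δ) * Y)
      ≤ Q * (1 - μ) * P * W * (d ^ μ * l ^ (-δ) * Y) := by gcongr
  have hQl : constL (2 * δ - 1) * l ^ (-δ) / (1 - (2 * δ - 1)) = Q * l ^ (-δ) := by
    rw [hQ]; ring
  rw [hQl]
  linarith

/-! ### Absorbing the subordinate main term; the three cases. -/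

theorem norm_coeffH_le {p₁ p₂ μ : ℝ} {U u : ℝ → ℂ} (hU : IsRegularPart p₁ p₂ μ 1 1 U u)
    (hp : p₁ < p₂) {p₀ : ℝ} (hp₀ : p₀ ∈ Icc p₁ p₂) (c ω : ℝ) :
    ‖coeffH u p₀ c ω‖ ≤ Real.sqrt Real.pi * linftyNorm p₁ p₂ u := by
  have h1 : ‖exp (-(I * (Real.pi / 4)))‖ = 1 := by
    have := norm_exp_I_mul_ofReal_mul (Real.pi / 4) (-1)
    simpa using this
  rw [coeffH, norm_mul, norm_mul, norm_mul, h1, norm_exp_I_mul_ofReal_mul, norm_real,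
    Real.norm_of_nonneg (Real.sqrt_nonneg _), mul_one, mul_one]
  exact mul_le_mul_of_nonneg_left (hU.norm_le hp hp₀) (Real.sqrt_nonneg _)

theorem norm_coeffK_le {p₁ p₂ μ : ℝ} {U u : ℝ → ℂ} (hU : IsRegularPart p₁ p₂ μ 1 1 U u)
    (hp : p₁ < p₂) (hμ : 0 < μ) (ψ : ℝ → ℝ) (ω : ℝ) :
    ‖coeffK μ ψ u p₁ ω‖ ≤ Real.Gamma μ / 2 ^ μ * linftyNorm p₁ p₂ u := by
  have h1 : ‖exp (I * (Real.pi * μ / 2))‖ = 1 := by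
    have := norm_exp_I_mul_ofReal_mul Real.pi (μ / 2)
    rw [← this]
    congr 2
    push_cast
    ring
  have hG : 0 ≤ Real.Gamma μ / 2 ^ μ := div_nonneg (Real.Gamma_pos_of_pos hμ).le (by positivity)
  rw [coeffK, norm_mul, norm_mul, norm_mul, h1, norm_exp_I_mul_ofReal_mul, norm_real,
    Real.norm_of_nonneg hG, mul_one, mul_one]
  exact mul_le_mul_of_nonneg_left (hU.norm_le hp (left_mem_Icc.2 hp.le)) hG

/-- Moving one of the main terms of an expansion into the error. -/
theorem norm_sub_left_le_of_norm_sub_add_le {x a b : ℂ} {A B t : ℝ} (ht : 0 ≤ t)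
    (h : ‖x - (a + b * (t : ℂ))‖ ≤ A) (hb : ‖b‖ ≤ B) : ‖x - a‖ ≤ B * t + A := by
  have h2 : x - a = b * (t : ℂ) + (x - (a + b * (t : ℂ))) := by ring
  rw [h2]
  refine (norm_add_le _ _).trans (add_le_add ?_ h)
  rw [norm_mul, norm_real, Real.norm_of_nonneg ht]
  exact mul_le_mul_of_nonneg_right hb ht

/-- The threshold on `ω` is exactly what places `p₀` to the left of `p₂`. -/
theorem rpow_neg_lt_of_rpow_neg_inv_lt {r ε ω : ℝ} (hr : 0 < r) (hε : 0 < ε)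
    (h : r ^ (-(1 / ε)) < ω) : ω ^ (-ε) < r := by
  have h1 := Real.rpow_lt_rpow_of_neg (Real.rpow_pos_of_pos hr _) h (neg_lt_zero.2 hε)
  rwa [← Real.rpow_mul hr.le, neg_mul_neg, one_div_mul_cancel hε.ne', Real.rpow_one] at h1

end OscInt

theorem theorem3p4
    (p₁ p₂ : ℝ) (hp : p₁ < p₂)
    (μ : ℝ) (hμ : μ ∈ Set.Ioo (0 : ℝ) 1)
    (U u : ℝ → ℂ) (hU : OscInt.IsRegularPart p₁ p₂ μ 1 1 U u)
    (hU₂ : Filter.Tendsto U (nhdsWithin p₂ (Set.Iio p₂)) (nhds 0))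
    (ε : ℝ) (hε : ε ∈ Set.Ioo (0 : ℝ) (1 / 2))
    (δ : ℝ) (hδ : δ ∈ Set.Ioo (1 / 2 : ℝ) 1) (hδε : 1 / 2 + ε < δ) (hδμ : μ < δ) :
    (1 / 2 < μ →
      (∀ k, 0 ≤ OscInt.const₁ p₁ p₂ μ δ u k) ∧
      (∀ k, -OscInt.beta₁ μ δ k + ε * OscInt.alpha₁ μ δ k < -(1 / 2) + ε * (1 - μ)) ∧
      ∀ c ω p₀ : ℝ, (p₂ - p₁) ^ (-(1 / ε)) < ω → p₀ = p₁ + ω ^ (-ε) →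
        IntervalIntegrable (OscInt.integrand U (OscInt.phase p₀ c) ω)
          MeasureTheory.volume p₁ p₂ ∧
        ‖(∫ p in p₁..p₂, OscInt.integrand U (OscInt.phase p₀ c) ω p)
            - OscInt.coeffH u p₀ c ω * ((ω ^ (-(1 / 2) + ε * (1 - μ)) : ℝ) : ℂ)‖
          ≤ ∑ k, OscInt.const₁ p₁ p₂ μ δ u k
              * ω ^ (-OscInt.beta₁ μ δ k + ε * OscInt.alpha₁ μ δ k)) ∧
    (μ = 1 / 2 →
      (∀ k, 0 ≤ OscInt.remConst p₁ p₂ μ δ u k) ∧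
      (∀ k, -OscInt.remBeta δ k + ε * OscInt.remAlpha μ δ k < -(1 / 2) + 1 / 2 * ε) ∧
      ∀ c ω p₀ : ℝ, (p₂ - p₁) ^ (-(1 / ε)) < ω → p₀ = p₁ + ω ^ (-ε) →
        IntervalIntegrable (OscInt.integrand U (OscInt.phase p₀ c) ω)
          MeasureTheory.volume p₁ p₂ ∧
        ‖(∫ p in p₁..p₂, OscInt.integrand U (OscInt.phase p₀ c) ω p)
            - (OscInt.coeffH u p₀ c ω + OscInt.coeffK μ (OscInt.phase p₀ c) u p₁ ω)
              * ((ω ^ (-(1 / 2) + 1 / 2 * ε) : ℝ) : ℂ)‖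
          ≤ ∑ k, OscInt.remConst p₁ p₂ μ δ u k
              * ω ^ (-OscInt.remBeta δ k + ε * OscInt.remAlpha μ δ k)) ∧
    (μ < 1 / 2 →
      (∀ k, 0 ≤ OscInt.const₃ p₁ p₂ μ δ u k) ∧
      (∀ k, -OscInt.beta₃ δ k + ε * OscInt.alpha₃ μ δ k < -μ + ε * μ) ∧
      ∀ c ω p₀ : ℝ, (p₂ - p₁) ^ (-(1 / ε)) < ω → p₀ = p₁ + ω ^ (-ε) →
        IntervalIntegrable (OscInt.integrand U (OscInt.phase p₀ c) ω)
          MeasureTheory.volume p₁ p₂ ∧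
        ‖(∫ p in p₁..p₂, OscInt.integrand U (OscInt.phase p₀ c) ω p)
            - OscInt.coeffK μ (OscInt.phase p₀ c) u p₁ ω * ((ω ^ (-μ + ε * μ) : ℝ) : ℂ)‖
          ≤ ∑ k, OscInt.const₃ p₁ p₂ μ δ u k
              * ω ^ (-OscInt.beta₃ δ k + ε * OscInt.alpha₃ μ δ k)) := by
  obtain ⟨hμ0, hμ1⟩ := hμ
  obtain ⟨hε0, hε1⟩ := hε
  obtain ⟨hδ0, hδ1⟩ := hδ
  have hnn := OscInt.remConst_nonneg hp hμ0 hμ1 hδ1 u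
  have hexp := OscInt.remExponent_lt (μ := μ) hε0 hε1 hδ0 hδε
  have hS := OscInt.linftyNorm_nonneg p₁ p₂ u
  have hΓ : 0 ≤ Real.Gamma μ / 2 ^ μ :=
    div_nonneg (Real.Gamma_pos_of_pos hμ0).le (by positivity)
  have key : ∀ c ω : ℝ, (p₂ - p₁) ^ (-(1 / ε)) < ω → 0 < ω ∧
      p₁ + ω ^ (-ε) ∈ Set.Icc p₁ p₂ ∧ _ := fun c ω hω => by
    have hω0 : 0 < ω := (Real.rpow_nonneg (by linarith) _).trans_lt hω
    have hd := OscInt.rpow_neg_lt_of_rpow_neg_inv_lt (by linarith) hε0 hω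
    have hd0 := Real.rpow_pos_of_pos hω0 (-ε)
    exact ⟨hω0, ⟨by linarith, by linarith⟩,
      OscInt.norm_integral_sub_two_terms_le (c := c) hp hμ0 hμ1 hU hU₂ hδ0 hδ1 hω0 hd⟩
  refine ⟨fun hμh => ⟨?_, ?_, ?_⟩, fun hμh => ⟨hnn, ?_, ?_⟩, fun hμh => ⟨?_, ?_, ?_⟩⟩
  · exact fun k => Fin.cases (mul_nonneg hΓ hS) hnn k
  · refine fun k => Fin.cases ?_ hexp k
    simp only [OscInt.beta₁, OscInt.alpha₁, Matrix.cons_val_zero]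
    -- The gap between the two exponents is `(μ - 1/2) * (1 - 2 * ε)`, positive here.
    nlinarith
  · rintro c ω p₀ hω rfl
    obtain ⟨hω0, -, h⟩ := key c ω hω
    refine ⟨hU.intervalIntegrable_integrand hp hμ0 _ _ _, ?_⟩
    rw [Fin.sum_univ_succ]
    exact OscInt.norm_sub_left_le_of_norm_sub_add_le (Real.rpow_nonneg hω0.le _) h
      (OscInt.norm_coeffK_le hU hp hμ0 _ _)
  · intro k
    have := hexp k
    rw [hμh] at this ⊢
    linarith
  · rintro c ω p₀ hω rfl
    obtain ⟨hω0, -, h⟩ := key c ω hω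
    refine ⟨hU.intervalIntegrable_integrand hp hμ0 _ _ _, ?_⟩
    have e1 : -(1 / 2) + ε * (1 - μ) = -(1 / 2) + 1 / 2 * ε := by rw [hμh]; ring
    have e2 : -μ + ε * μ = -(1 / 2) + 1 / 2 * ε := by rw [hμh]; ring
    rwa [e1, e2, ← add_mul] at h
  · exact fun k => Fin.cases (mul_nonneg (Real.sqrt_nonneg _) hS) hnn k
  · have hlt : -(1 / 2) + ε * (1 - μ) < -μ + ε * μ := by nlinarith
    refine fun k => Fin.cases ?_ (fun i => (hexp i).trans hlt) k
    exact hlt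
  · rintro c ω p₀ hω rfl
    obtain ⟨hω0, hp₀, h⟩ := key c ω hω
    refine ⟨hU.intervalIntegrable_integrand hp hμ0 _ _ _, ?_⟩
    rw [Fin.sum_univ_succ]
    -- The absorption lemma keeps the first summand, which must now be the `K̃` term.
    rw [add_comm (OscInt.coeffH u _ c ω * _)] at h
    exact OscInt.norm_sub_left_le_of_norm_sub_add_le (Real.rpow_nonneg hω0.le _) h
      (OscInt.norm_coeffH_le hU hp hp₀ _ _)
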